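/- Let $m,k\in\mathbb N$ and let $C^*(m,k)$ denote the universal unital C*-algebra generated by elements $P_{a|x}$ ($1\le a\le k$, $1\le x\le m$) subject to the relations $P_{a|x}=P_{a|x}^*=P_{a|x}^2$ for all $a,x$ and $\sum_{a=1}^k P_{a|x}=1$ for every $x$. A PVM in a unital C*-algebra is a finite family of projections (self-adjoint idempotents) with sum $1$; $S(D)$ denotes the set of states (positive linear functionals $\phi$ with $\phi(1)=1$) of a unital C*-algebra $D$; $\otimes_{max}$ and $\otimes_{min}$ denote the maximal and minimal C*-tensor products. For a unital C*-algebra $D$, let $\mathbf{qA}(m,k,D)$ be the set of families $(\sigma_{a|x})_{1\le a\le k,\,1\le x\le m}$ of positive linear functionals on $D$ for which there are a Hilbert space $H$, PVMs $(P_{a|x})_{a=1}^k$ in $B(H)$ for $x=1,\dots,m$, and a state $\phi\in S(B(H)\otimes_{min}D)$ with $\sigma_{a|x}(d)=\phi(P_{a|x}\otimes d)$ for all $a,x$ and all $d\in D$ (quantum tensor assemblages). Let $\mathbf{qcA}(m,k,D)$ be the set of families $(\sigma_{a|x})$ of positive linear functionals on $D$ for which there are a unital inclusion $D\subset B(H)$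 for some Hilbert space $H$, PVMs $(P_{a|x})_{a=1}^k$ in the commutant $D'\subset B(H)$ for $x=1,\dots,m$, and a state $\phi\in S(B(H))$ with $\sigma_{a|x}(d)=\phi(P_{a|x}d)$ for all $a,x$ and all $d\in D$ (quantum commuting assemblages). Theorem. Let $B$ be a unital C*-algebra. Then $C^*(m,k)\otimes_{max}B=C^*(m,k)\otimes_{min}B$ (that is, the maximal and the minimal C*-norm coincide on the algebraic tensor product $C^*(m,k)\otimes B$) if and only if $\mathbf{qA}(m,k,M_n(B))=\mathbf{qcA}(m,k,M_n(B))$ for every $n\in\mathbb N$. -/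

import Mathlib

universe u v w

open scoped TensorProduct

/-! ### C*-seminorms and their completions -/

noncomputable section CStarSeminorm

/-- A C*-seminorm on a complex unital *-algebra: a seminorm `p` with `p (a * b) ≤ p a * p b` and
`p (star a * a) = p a ^ 2`. -/
structure CStarSeminorm (A : Type u) [Ring A] [StarRing A] [Algebra ℂ A] extends Seminorm ℂ A where
  mul_le (a b : A) : toFun (a * b) ≤ toFun a * toFun b
  star_mul_self (a : A) : toFun (star a * a) = toFun a ^ 2

namespace CStarSeminorm

variable {A : Type u} [Ring A] [StarRing A] [Algebra ℂ A]

instance : CoeFun (CStarSeminorm A) (fun _ => A → ℝ) := ⟨fun p => p.toSeminorm⟩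

theorem le_star (p : CStarSeminorm A) (a : A) : p a ≤ p (star a) := by
  have h1 := p.star_mul_self a
  have h2 := p.mul_le (star a) a
  have h3 : 0 ≤ p.toSeminorm a := apply_nonneg _ _
  have h4 : 0 ≤ p.toSeminorm (star a) := apply_nonneg _ _
  change p.toSeminorm (star a * a) = p.toSeminorm a ^ 2 at h1
  change p.toSeminorm (star a * a) ≤ p.toSeminorm (star a) * p.toSeminorm a at h2
  by_contra! h
  change p.toSeminorm (star a) < p.toSeminorm a at h
  nlinarith

theorem star_eq (p : CStarSeminorm A) (a : A) : p (star a) = p a :=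
  le_antisymm (by simpa using p.le_star (star a)) (p.le_star a)

variable (p : CStarSeminorm A)

/-- The seminormed ring structure on `A` given by the C*-seminorm `p`. -/
abbrev toSeminormedRing : SeminormedRing A :=
  { ‹Ring A›, p.toSeminorm.toAddGroupSeminorm.toSeminormedAddCommGroup with
    norm_mul_le := p.mul_le }

/-- The *-algebra `A`, regarded as a seminormed algebra through the C*-seminorm `p`. -/
def Carrier (_ : CStarSeminorm A) : Type u := A

instance : SeminormedRing p.Carrier := p.toSeminormedRing

instance : StarRing p.Carrier := (inferInstance : StarRing A)

instance : Algebra ℂ p.Carrier := (inferInstance : Algebra ℂ A)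

instance [StarModule ℂ A] : StarModule ℂ p.Carrier := (inferInstance : StarModule ℂ A)

theorem norm_carrier (a : p.Carrier) : ‖a‖ = p a := rfl

instance : NormedAlgebra ℂ p.Carrier where
  norm_smul_le r a := (map_smul_eq_mul p.toSeminorm r a).le

instance : NormedStarGroup p.Carrier where
  norm_star_le a := (p.star_eq a).le

/-- The C*-completion of `A` with respect to the C*-seminorm `p`: the Hausdorff completion
of `A`, with the operations extended by continuity. -/
def Completion : Type u := UniformSpace.Completion p.Carrier

instance : NormedRing p.Completion :=
  inferInstanceAs (NormedRing (UniformSpace.Completion p.Carrier))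

instance : CompleteSpace p.Completion :=
  inferInstanceAs (CompleteSpace (UniformSpace.Completion p.Carrier))

instance : Algebra ℂ p.Completion :=
  inferInstanceAs (Algebra ℂ (UniformSpace.Completion p.Carrier))

instance : NormedAlgebra ℂ p.Completion where
  norm_smul_le := norm_smul_le (α := ℂ) (β := UniformSpace.Completion p.Carrier)

/-- The canonical unital homomorphism from `A` to its completion. -/
def toCompletionAlgHom : A →ₐ[ℂ] p.Completion where
  toFun a := ((show p.Carrier from a : p.Carrier) : UniformSpace.Completion p.Carrier)
  map_one' := UniformSpace.Completion.coe_one p.Carrier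
  map_mul' := UniformSpace.Completion.coe_mul (α := p.Carrier)
  map_zero' := UniformSpace.Completion.coe_zero (α := p.Carrier)
  map_add' := UniformSpace.Completion.coe_add (α := p.Carrier)
  commutes' _ := rfl

theorem norm_toCompletionAlgHom (a : A) : ‖p.toCompletionAlgHom a‖ = p a :=
  UniformSpace.Completion.norm_coe (E := p.Carrier) a

theorem induction_completion {q : p.Completion → Prop} (x : p.Completion)
    (hc : IsClosed {x | q x}) (h : ∀ a : A, q (p.toCompletionAlgHom a)) : q x :=
  UniformSpace.Completion.induction_on (α := p.Carrier) x hc h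

instance : Star p.Completion where
  star := UniformSpace.Completion.map (star : p.Carrier → p.Carrier)

theorem continuous_star_completion : Continuous (star : p.Completion → p.Completion) :=
  UniformSpace.Completion.continuous_map

theorem star_toCompletionAlgHom (a : A) :
    star (p.toCompletionAlgHom a) = p.toCompletionAlgHom (star a) :=
  UniformSpace.Completion.map_coe (α := p.Carrier) (β := p.Carrier)
    (starNormedAddGroupHom (E := p.Carrier)).uniformContinuous a

instance : StarRing p.Completion where
  star_involutive x := p.induction_completion (q := fun x => star (star x) = x) x
    (isClosed_eq (p.continuous_star_completion.comp p.continuous_star_completion) continuous_id)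
    fun a => by rw [star_toCompletionAlgHom, star_toCompletionAlgHom, star_star]
  star_mul x y := by
    refine p.induction_completion (q := fun x => star (x * y) = star y * star x) x
      (isClosed_eq (p.continuous_star_completion.comp (continuous_id.mul continuous_const))
        (continuous_const.mul p.continuous_star_completion)) fun a => ?_
    refine p.induction_completion
      (q := fun y => star (p.toCompletionAlgHom a * y) = star y * star (p.toCompletionAlgHom a)) y
      (isClosed_eq (p.continuous_star_completion.comp (continuous_const.mul continuous_id))
        (p.continuous_star_completion.mul continuous_const)) fun b => ?_
    rw [← map_mul, star_toCompletionAlgHom, star_toCompletionAlgHom, star_toCompletionAlgHom,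
      ← map_mul, star_mul]
  star_add x y := by
    refine p.induction_completion (q := fun x => star (x + y) = star x + star y) x
      (isClosed_eq (p.continuous_star_completion.comp (continuous_id.add continuous_const))
        (p.continuous_star_completion.add continuous_const)) fun a => ?_
    refine p.induction_completion
      (q := fun y => star (p.toCompletionAlgHom a + y) = star (p.toCompletionAlgHom a) + star y) y
      (isClosed_eq (p.continuous_star_completion.comp (continuous_const.add continuous_id))
        (continuous_const.add p.continuous_star_completion)) fun b => ?_
    rw [← map_add, star_toCompletionAlgHom, star_toCompletionAlgHom, star_toCompletionAlgHom,
      ← map_add, star_add]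

instance : CStarRing p.Completion where
  norm_mul_self_le x := by
    refine p.induction_completion (q := fun x => ‖x‖ * ‖x‖ ≤ ‖star x * x‖) x
      (isClosed_le (continuous_norm.mul continuous_norm)
        (p.continuous_star_completion.mul continuous_id).norm) fun a => ?_
    rw [star_toCompletionAlgHom, ← map_mul, norm_toCompletionAlgHom, norm_toCompletionAlgHom, ← sq]
    exact (p.star_mul_self a).ge

instance [StarModule ℂ A] : CStarAlgebra p.Completion where
  star_smul r x := p.induction_completion (q := fun x => star (r • x) = star r • star x) x
    (isClosed_eq (p.continuous_star_completion.comp (continuous_const_smul r))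
      ((continuous_const_smul (star r)).comp p.continuous_star_completion)) fun a => by
    rw [← map_smul, star_toCompletionAlgHom, star_toCompletionAlgHom, star_smul, map_smul]

/-- The canonical unital *-homomorphism from `A` to its completion. -/
def toCompletion : A →⋆ₐ[ℂ] p.Completion where
  __ := p.toCompletionAlgHom
  map_star' a := (p.star_toCompletionAlgHom a).symm

/-- The C*-seminorm `a ↦ ‖f a‖` of a *-homomorphism `f` into a C*-algebra. -/
def ofHom {D : Type v} [CStarAlgebra D] (f : A →⋆ₐ[ℂ] D) : CStarSeminorm A where
  toSeminorm := (normSeminorm ℂ D).comp f.toAlgHom.toLinearMap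
  mul_le a b := by
    change ‖f (a * b)‖ ≤ ‖f a‖ * ‖f b‖
    rw [map_mul]; exact norm_mul_le _ _
  star_mul_self a := by
    change ‖f (star a * a)‖ = ‖f a‖ ^ 2
    rw [map_mul, map_star, CStarRing.norm_star_mul_self, sq]

theorem ofHom_apply {D : Type v} [CStarAlgebra D] (f : A →⋆ₐ[ℂ] D) (a : A) :
    ofHom f a = ‖f a‖ := rfl

/-- The pointwise supremum of a pointwise bounded set of C*-seminorms. -/
def pointwiseSup (S : Set (CStarSeminorm A))
    (hS : ∀ a : A, BddAbove (Set.range fun q : S => q.1 a)) : CStarSeminorm A where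
  toFun a := ⨆ q : S, q.1 a
  map_zero' := by simp
  add_le' a b := Real.iSup_le (fun q => (map_add_le_add q.1.toSeminorm a b).trans
    (add_le_add (le_ciSup (hS a) q) (le_ciSup (hS b) q)))
    (add_nonneg (Real.iSup_nonneg fun q => apply_nonneg q.1.toSeminorm a)
      (Real.iSup_nonneg fun q => apply_nonneg q.1.toSeminorm b))
  neg' a := by simp
  smul' r a := by simp [map_smul_eq_mul, Real.mul_iSup_of_nonneg]
  mul_le a b := Real.iSup_le (fun q => (q.1.mul_le a b).trans
    (mul_le_mul (le_ciSup (hS a) q) (le_ciSup (hS b) q) (apply_nonneg q.1.toSeminorm b)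
      (Real.iSup_nonneg fun q => apply_nonneg q.1.toSeminorm a)))
    (mul_nonneg (Real.iSup_nonneg fun q => apply_nonneg q.1.toSeminorm a)
      (Real.iSup_nonneg fun q => apply_nonneg q.1.toSeminorm b))
  star_mul_self a := by
    have h0 : ∀ q : S, 0 ≤ q.1 a := fun q => apply_nonneg q.1.toSeminorm a
    have hs : ∀ q : S, q.1 (star a * a) = q.1 a ^ 2 := fun q => q.1.star_mul_self a
    have hn : 0 ≤ ⨆ q : S, q.1 a := Real.iSup_nonneg h0
    refine le_antisymm (Real.iSup_le (fun q => ?_) (by positivity)) ?_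
    · rw [hs]
      exact pow_le_pow_left₀ (h0 q) (le_ciSup (hS a) q) 2
    · have hn' : 0 ≤ ⨆ q : S, q.1 (star a * a) :=
        Real.iSup_nonneg fun q => apply_nonneg q.1.toSeminorm _
      rw [← Real.le_sqrt hn hn']
      refine Real.iSup_le (fun q => ?_) (Real.sqrt_nonneg _)
      rw [Real.le_sqrt (h0 q) hn', ← hs]
      exact le_ciSup (hS (star a * a)) q

end CStarSeminorm

end CStarSeminorm

/-! ### Maximal and minimal tensor products -/

section TensorProducts

variable (A : Type u) (B : Type v) [CStarAlgebra A] [CStarAlgebra B]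

/-- The unital *-homomorphism `a ↦ a ⊗ 1` into the algebraic tensor product. -/
noncomputable def tensorInclLeft : A →⋆ₐ[ℂ] A ⊗[ℂ] B where
  __ := (Algebra.TensorProduct.includeLeft : A →ₐ[ℂ] A ⊗[ℂ] B)
  map_star' a := by simp

/-- The unital *-homomorphism `b ↦ 1 ⊗ b` into the algebraic tensor product. -/
noncomputable def tensorInclRight : B →⋆ₐ[ℂ] A ⊗[ℂ] B where
  __ := (Algebra.TensorProduct.includeRight : B →ₐ[ℂ] A ⊗[ℂ] B)
  map_star' a := by simp

variable {A B}

theorem StarAlgHom_norm_le {D : Type w} [CStarAlgebra D] (f : A →⋆ₐ[ℂ] D) (a : A) :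
    ‖f a‖ ≤ ‖a‖ := NonUnitalStarAlgHom.norm_apply_le f a

theorem CStarSeminorm.apply_tmul_le (q : CStarSeminorm (A ⊗[ℂ] B)) (a : A) (b : B) :
    q (a ⊗ₜ[ℂ] b) ≤ ‖a‖ * ‖b‖ := by
  have ha : q (a ⊗ₜ[ℂ] (1 : B)) ≤ ‖a‖ :=
    (q.norm_toCompletionAlgHom _).symm.le.trans
      (StarAlgHom_norm_le (q.toCompletion.comp (tensorInclLeft A B)) a)
  have hb : q ((1 : A) ⊗ₜ[ℂ] b) ≤ ‖b‖ :=
    (q.norm_toCompletionAlgHom _).symm.le.trans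
      (StarAlgHom_norm_le (q.toCompletion.comp (tensorInclRight A B)) b)
  calc q (a ⊗ₜ[ℂ] b) = q ((a ⊗ₜ[ℂ] (1 : B)) * ((1 : A) ⊗ₜ[ℂ] b)) := by simp
    _ ≤ q (a ⊗ₜ[ℂ] (1 : B)) * q ((1 : A) ⊗ₜ[ℂ] b) := q.mul_le _ _
    _ ≤ ‖a‖ * ‖b‖ := mul_le_mul ha hb (apply_nonneg q.toSeminorm _) (norm_nonneg _)

theorem CStarSeminorm.exists_bound_tensor (x : A ⊗[ℂ] B) :
    ∃ C : ℝ, ∀ q : CStarSeminorm (A ⊗[ℂ] B), q x ≤ C := by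
  induction x using TensorProduct.induction_on with
  | zero => exact ⟨0, fun q => (map_zero q.toSeminorm).le⟩
  | tmul a b => exact ⟨‖a‖ * ‖b‖, fun q => q.apply_tmul_le a b⟩
  | add x y hx hy =>
    obtain ⟨C, hC⟩ := hx
    obtain ⟨D, hD⟩ := hy
    exact ⟨C + D, fun q => (map_add_le_add q.toSeminorm x y).trans (add_le_add (hC q) (hD q))⟩

theorem CStarSeminorm.bddAbove_tensor (S : Set (CStarSeminorm (A ⊗[ℂ] B))) (x : A ⊗[ℂ] B) :
    BddAbove (Set.range fun q : S => q.1 x) := by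
  obtain ⟨C, hC⟩ := CStarSeminorm.exists_bound_tensor x
  exact ⟨C, by rintro _ ⟨q, rfl⟩; exact hC q.1⟩

variable (A B)

/-- The maximal C*-norm on `A ⊗ B`: the largest C*-seminorm on the algebraic tensor product. -/
noncomputable def maxTensorNorm : CStarSeminorm (A ⊗[ℂ] B) :=
  CStarSeminorm.pointwiseSup Set.univ (CStarSeminorm.bddAbove_tensor _)

section Spatial

variable (H : Type u) (K : Type v) [NormedAddCommGroup H] [InnerProductSpace ℂ H]
  [NormedAddCommGroup K] [InnerProductSpace ℂ K]

/-- The Hilbert space tensor product: the completion of the algebraic tensor product with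
`⟪x ⊗ y, x' ⊗ y'⟫ = ⟪x, x'⟫ * ⟪y, y'⟫`. -/
def HilbertTensor : Type (max u v) := UniformSpace.Completion (H ⊗[ℂ] K)

noncomputable instance : NormedAddCommGroup (HilbertTensor H K) :=
  (inferInstance : NormedAddCommGroup (UniformSpace.Completion (H ⊗[ℂ] K)))

noncomputable instance : InnerProductSpace ℂ (HilbertTensor H K) :=
  (inferInstance : InnerProductSpace ℂ (UniformSpace.Completion (H ⊗[ℂ] K)))

instance : CompleteSpace (HilbertTensor H K) :=
  (inferInstance : CompleteSpace (UniformSpace.Completion (H ⊗[ℂ] K)))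

variable {H K}

/-- The elementary tensor `x ⊗ y` in the Hilbert space tensor product. -/
noncomputable def hilbertTmul (x : H) (y : K) : HilbertTensor H K :=
  UniformSpace.Completion.coe' (x ⊗ₜ[ℂ] y)

/-- The operator `S ⊗ T` on the Hilbert space tensor product, `x ⊗ y ↦ S x ⊗ T y`. -/
noncomputable def opTensor (S : H →L[ℂ] H) (T : K →L[ℂ] K) :
    HilbertTensor H K →L[ℂ] HilbertTensor H K :=
  (TensorProduct.mapL S T).completion

theorem opTensor_ext {X Y : HilbertTensor H K →L[ℂ] HilbertTensor H K}
    (h : ∀ (x : H) (y : K), X (hilbertTmul x y) = Y (hilbertTmul x y)) : X = Y := by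
  ext z
  refine UniformSpace.Completion.induction_on (α := H ⊗[ℂ] K) z
    (isClosed_eq X.continuous Y.continuous) fun z => ?_
  induction z using TensorProduct.induction_on with
  | zero => exact (map_zero X).trans (map_zero Y).symm
  | tmul x y => exact h x y
  | add x y hx hy =>
    have e := UniformSpace.Completion.coe_add (α := H ⊗[ℂ] K) x y
    exact (congrArg X e).trans ((map_add X _ _).trans ((congrArg₂ _ hx hy).trans
      ((map_add Y _ _).symm.trans (congrArg Y e.symm))))

theorem opTensor_tmul (S : H →L[ℂ] H) (T : K →L[ℂ] K) (x : H) (y : K) :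
    opTensor S T (hilbertTmul x y) = hilbertTmul (S x) (T y) :=
  ContinuousLinearMap.completion_apply_coe (TensorProduct.mapL S T) (x ⊗ₜ[ℂ] y)

theorem hilbertTmul_add (x : H) (y y' : K) :
    hilbertTmul x (y + y') = hilbertTmul x y + hilbertTmul x y' :=
  (congrArg UniformSpace.Completion.coe' (TensorProduct.tmul_add x y y')).trans
    (UniformSpace.Completion.coe_add _ _)

theorem add_hilbertTmul (x x' : H) (y : K) :
    hilbertTmul (x + x') y = hilbertTmul x y + hilbertTmul x' y :=
  (congrArg UniformSpace.Completion.coe' (TensorProduct.add_tmul x x' y)).trans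
    (UniformSpace.Completion.coe_add _ _)

theorem hilbertTmul_smul (r : ℂ) (x : H) (y : K) :
    hilbertTmul x (r • y) = r • hilbertTmul x y :=
  (congrArg UniformSpace.Completion.coe' (TensorProduct.tmul_smul r x y)).trans
    (UniformSpace.Completion.coe_smul _ _)

theorem smul_hilbertTmul (r : ℂ) (x : H) (y : K) :
    hilbertTmul (r • x) y = r • hilbertTmul x y :=
  (congrArg UniformSpace.Completion.coe' (TensorProduct.smul_tmul' r x y).symm).trans
    (UniformSpace.Completion.coe_smul _ _)

theorem star_opTensor [CompleteSpace H] [CompleteSpace K] (S : H →L[ℂ] H) (T : K →L[ℂ] K) :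
    star (opTensor S T) = opTensor (star S) (star T) := by
  rw [ContinuousLinearMap.star_eq_adjoint]
  symm
  rw [ContinuousLinearMap.eq_adjoint_iff]
  intro z w
  refine UniformSpace.Completion.induction_on₂ (α := H ⊗[ℂ] K) (β := H ⊗[ℂ] K)
    (p := fun z w => inner ℂ (opTensor (star S) (star T) z) w = inner ℂ z (opTensor S T w)) z w
    (isClosed_eq (((opTensor (star S) (star T)).continuous.comp continuous_fst).inner
        continuous_snd)
      (continuous_fst.inner ((opTensor S T).continuous.comp continuous_snd))) fun z w => ?_
  have key : inner ℂ (TensorProduct.mapL (star S) (star T) z) w =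
      inner ℂ z (TensorProduct.mapL S T w) := by
    induction z using TensorProduct.induction_on with
    | zero => simp
    | add x y hx hy => rw [map_add, inner_add_left, inner_add_left, hx, hy]
    | tmul x y =>
      induction w using TensorProduct.induction_on with
      | zero => simp
      | add x y hx hy => rw [map_add, inner_add_right, inner_add_right, hx, hy]
      | tmul x' y' =>
        simp [ContinuousLinearMap.star_eq_adjoint, ContinuousLinearMap.adjoint_inner_left]
  have h1 := ContinuousLinearMap.completion_apply_coe (TensorProduct.mapL (star S) (star T)) z
  have h2 := ContinuousLinearMap.completion_apply_coe (TensorProduct.mapL S T) w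
  refine (congrArg (fun t => inner ℂ t (w : UniformSpace.Completion (H ⊗[ℂ] K))) h1).trans ?_
  have e1 := UniformSpace.Completion.inner_coe (𝕜 := ℂ)
    (TensorProduct.mapL (star S) (star T) z) w
  have e2 := UniformSpace.Completion.inner_coe (𝕜 := ℂ) z (TensorProduct.mapL S T w)
  refine (e1.trans (Eq.trans ?_ e2.symm)).trans ?_
  · exact key
  exact (congrArg (fun t => inner ℂ (z : UniformSpace.Completion (H ⊗[ℂ] K)) t) h2).symm

variable {A B} [CompleteSpace H] [CompleteSpace K]

/-- The homomorphism `a ⊗ b ↦ π a ⊗ ρ b` into the operators on the Hilbert space tensor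
product. -/
noncomputable def spatialAlgHom (π : A →⋆ₐ[ℂ] (H →L[ℂ] H)) (ρ : B →⋆ₐ[ℂ] (K →L[ℂ] K)) :
    A ⊗[ℂ] B →ₐ[ℂ] (HilbertTensor H K →L[ℂ] HilbertTensor H K) :=
  Algebra.TensorProduct.algHomOfLinearMapTensorProduct
    (TensorProduct.lift (LinearMap.mk₂ ℂ (fun (a : A) (b : B) => opTensor (π a) (ρ b))
      (fun a a' b => opTensor_ext fun x y => by simp [opTensor_tmul, add_hilbertTmul])
      (fun r a b => opTensor_ext fun x y => by simp [opTensor_tmul, smul_hilbertTmul])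
      (fun a b b' => opTensor_ext fun x y => by simp [opTensor_tmul, hilbertTmul_add])
      (fun r a b => opTensor_ext fun x y => by simp [opTensor_tmul, hilbertTmul_smul])))
    (fun a a' b b' => opTensor_ext fun x y => by simp [opTensor_tmul])
    (opTensor_ext fun x y => by simp [opTensor_tmul])

theorem spatialAlgHom_tmul (π : A →⋆ₐ[ℂ] (H →L[ℂ] H)) (ρ : B →⋆ₐ[ℂ] (K →L[ℂ] K))
    (a : A) (b : B) : spatialAlgHom π ρ (a ⊗ₜ[ℂ] b) = opTensor (π a) (ρ b) := rfl

theorem spatialAlgHom_star (π : A →⋆ₐ[ℂ] (H →L[ℂ] H)) (ρ : B →⋆ₐ[ℂ] (K →L[ℂ] K))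
    (x : A ⊗[ℂ] B) : spatialAlgHom π ρ (star x) = star (spatialAlgHom π ρ x) := by
  induction x using TensorProduct.induction_on with
  | zero => rw [star_zero, map_zero, star_zero]
  | add x y hx hy => rw [star_add, map_add, map_add, hx, hy, star_add]
  | tmul a b =>
    rw [TensorProduct.star_tmul, spatialAlgHom_tmul, spatialAlgHom_tmul, star_opTensor, map_star,
      map_star]

/-- The representation `π ⊗ ρ` of `A ⊗ B` on the Hilbert space tensor product, given by
`a ⊗ b ↦ π a ⊗ ρ b`. -/
noncomputable def spatialRep (π : A →⋆ₐ[ℂ] (H →L[ℂ] H)) (ρ : B →⋆ₐ[ℂ] (K →L[ℂ] K)) :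
    A ⊗[ℂ] B →⋆ₐ[ℂ] (HilbertTensor H K →L[ℂ] HilbertTensor H K) where
  __ := spatialAlgHom π ρ
  map_star' := spatialAlgHom_star π ρ

theorem spatialRep_tmul (π : A →⋆ₐ[ℂ] (H →L[ℂ] H)) (ρ : B →⋆ₐ[ℂ] (K →L[ℂ] K)) (a : A) (b : B) :
    spatialRep π ρ (a ⊗ₜ[ℂ] b) = opTensor (π a) (ρ b) := rfl

end Spatial

/-- The minimal (spatial) C*-norm on `A ⊗ B`: the supremum of `‖(π ⊗ ρ) x‖` over all
representations `π` of `A` and `ρ` of `B` on Hilbert spaces. -/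
noncomputable def minTensorNorm : CStarSeminorm (A ⊗[ℂ] B) :=
  CStarSeminorm.pointwiseSup
    {p | ∃ (H : Type u) (_ : NormedAddCommGroup H) (_ : InnerProductSpace ℂ H)
      (_ : CompleteSpace H) (K : Type v) (_ : NormedAddCommGroup K) (_ : InnerProductSpace ℂ K)
      (_ : CompleteSpace K) (π : A →⋆ₐ[ℂ] (H →L[ℂ] H)) (ρ : B →⋆ₐ[ℂ] (K →L[ℂ] K)),
      p = CStarSeminorm.ofHom (spatialRep π ρ)}
    (CStarSeminorm.bddAbove_tensor _)

/-- The maximal tensor product of unital C*-algebras. -/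
abbrev MaxTensor : Type (max u v) := (maxTensorNorm A B).Completion

/-- The minimal tensor product of unital C*-algebras. -/
abbrev MinTensor : Type (max u v) := (minTensorNorm A B).Completion

/-- `A ⊗_max B = A ⊗_min B`: the maximal and the minimal C*-norm agree on the algebraic tensor
product (so that the two completions coincide). -/
def IsNuclearPair : Prop := maxTensorNorm A B = minTensorNorm A B

end TensorProducts

/-! ### The universal C*-algebra of `m` projective measurements with `k` outcomes -/

section Universal

/-- The free unital complex *-algebra on self-adjoint generators indexed by `X`, i.e. complex
noncommutative polynomials, realised as the monoid algebra of words. -/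
def FreeStarAlgebra (X : Type u) : Type u := MonoidAlgebra ℂ (FreeMonoid X)

namespace FreeStarAlgebra

variable {X : Type u}

noncomputable instance : Ring (FreeStarAlgebra X) :=
  inferInstanceAs (Ring (MonoidAlgebra ℂ (FreeMonoid X)))

noncomputable instance : Algebra ℂ (FreeStarAlgebra X) :=
  inferInstanceAs (Algebra ℂ (MonoidAlgebra ℂ (FreeMonoid X)))

/-- The monomial `c • w`, for a word `w` in the generators. -/
noncomputable def monomial (w : FreeMonoid X) (c : ℂ) : FreeStarAlgebra X :=
  MonoidAlgebra.single w c

/-- The self-adjoint generators. -/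
noncomputable def gen (x : X) : FreeStarAlgebra X := monomial (FreeMonoid.of x) 1

theorem monomial_mul (w w' : FreeMonoid X) (c c' : ℂ) :
    monomial w c * monomial w' c' = monomial (w * w') (c * c') :=
  MonoidAlgebra.single_mul_single w w' c c'

theorem induction_monomial {q : FreeStarAlgebra X → Prop} (x : FreeStarAlgebra X) (h0 : q 0)
    (hadd : ∀ x y, q x → q y → q (x + y)) (hm : ∀ w c, q (monomial w c)) : q x :=
  MonoidAlgebra.induction_linear (motive := q) x h0 hadd hm

/-- The involution: it conjugates coefficients and reverses words. -/
noncomputable instance : Star (FreeStarAlgebra X) where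
  star f := MonoidAlgebra.mapDomain (star : FreeMonoid X → FreeMonoid X)
    (MonoidAlgebra.mapRingHom (FreeMonoid X) (starRingEnd ℂ) f)

theorem star_monomial (w : FreeMonoid X) (c : ℂ) :
    star (monomial w c) = monomial (star w) (star c) := by
  change MonoidAlgebra.mapDomain _ (MonoidAlgebra.mapRingHom _ _ (MonoidAlgebra.single w c)) = _
  rw [MonoidAlgebra.mapRingHom_single, MonoidAlgebra.mapDomain_single]
  rfl

theorem star_add_aux (f g : FreeStarAlgebra X) : star (f + g) = star f + star g := by
  exact (congrArg (MonoidAlgebra.mapDomain _) (map_add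
    (MonoidAlgebra.mapRingHom (FreeMonoid X) (starRingEnd ℂ)) f g)).trans
    (MonoidAlgebra.mapDomain_add _ _ _)

theorem star_zero_aux : star (0 : FreeStarAlgebra X) = 0 := by
  simpa using star_add_aux (0 : FreeStarAlgebra X) 0

noncomputable instance : StarRing (FreeStarAlgebra X) where
  star_involutive f := by
    induction f using induction_monomial with
    | h0 => simp [star_zero_aux]
    | hadd x y hx hy => rw [star_add_aux, star_add_aux, hx, hy]
    | hm w c => simp [star_monomial]
  star_mul f g := by
    induction f using induction_monomial with
    | h0 => simp [star_zero_aux]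
    | hadd x y hx hy => rw [add_mul, star_add_aux, star_add_aux, mul_add, hx, hy]
    | hm w c =>
      induction g using induction_monomial with
      | h0 => simp [star_zero_aux]
      | hadd x y hx hy => rw [mul_add, star_add_aux, star_add_aux, add_mul, hx, hy]
      | hm w' c' => simp [star_monomial, monomial_mul, mul_comm]
  star_add := star_add_aux

theorem smul_monomial (r : ℂ) (w : FreeMonoid X) (c : ℂ) :
    r • monomial w c = monomial w (r * c) := MonoidAlgebra.smul_single r w c

instance : StarModule ℂ (FreeStarAlgebra X) where
  star_smul r f := by
    induction f using induction_monomial with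
    | h0 => simp
    | hadd x y hx hy => rw [smul_add, star_add, star_add, smul_add, hx, hy]
    | hm w c => simp [star_monomial, smul_monomial]

theorem star_gen (x : X) : star (gen x) = gen x := by simp [gen, star_monomial]

end FreeStarAlgebra

variable (m k : ℕ)

/-- The C*-seminorms on the free *-algebra on self-adjoint generators `P_{a|x}` that vanish on the
relations `P_{a|x} ^ 2 = P_{a|x}` and `∑ a, P_{a|x} = 1`. -/
def pvmSeminorms : Set (CStarSeminorm (FreeStarAlgebra (Fin k × Fin m))) :=
  {q | (∀ a x, q (FreeStarAlgebra.gen (a, x) * FreeStarAlgebra.gen (a, x) -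
      FreeStarAlgebra.gen (a, x)) = 0) ∧
    ∀ x, q (∑ a, FreeStarAlgebra.gen (a, x) - 1) = 0}

theorem CStarSeminorm.apply_one_le {A : Type u} [Ring A] [StarRing A] [Algebra ℂ A]
    (q : CStarSeminorm A) : q 1 ≤ 1 := by
  have h : q (star 1 * 1) = q 1 ^ 2 := q.star_mul_self 1
  rw [star_one, one_mul] at h
  nlinarith [sq_nonneg (q 1 - 1)]

theorem pvmSeminorms_gen_le {q : CStarSeminorm (FreeStarAlgebra (Fin k × Fin m))}
    (hq : q ∈ pvmSeminorms m k) (i : Fin k × Fin m) : q (FreeStarAlgebra.gen i) ≤ 1 := by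
  have h : q (star (FreeStarAlgebra.gen i) * FreeStarAlgebra.gen i) = _ := q.star_mul_self _
  have h2 : q (FreeStarAlgebra.gen i * FreeStarAlgebra.gen i) ≤
      q (FreeStarAlgebra.gen i * FreeStarAlgebra.gen i - FreeStarAlgebra.gen i) +
        q (FreeStarAlgebra.gen i) := by
    simpa using map_add_le_add q.toSeminorm
      (FreeStarAlgebra.gen i * FreeStarAlgebra.gen i - FreeStarAlgebra.gen i)
      (FreeStarAlgebra.gen i)
  rw [FreeStarAlgebra.star_gen] at h
  rw [hq.1 i.1 i.2, zero_add, h] at h2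
  change q (FreeStarAlgebra.gen i) ^ 2 ≤ q (FreeStarAlgebra.gen i) at h2
  nlinarith [sq_nonneg (q (FreeStarAlgebra.gen i) - 1)]

theorem pvmSeminorms_monomial_le {q : CStarSeminorm (FreeStarAlgebra (Fin k × Fin m))}
    (hq : q ∈ pvmSeminorms m k) (w : FreeMonoid (Fin k × Fin m)) :
    q (FreeStarAlgebra.monomial w 1) ≤ 1 := by
  induction w using FreeMonoid.recOn with
  | one => exact q.apply_one_le
  | of_mul i w hw =>
    have h := q.mul_le (FreeStarAlgebra.gen i) (FreeStarAlgebra.monomial w 1)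
    rw [FreeStarAlgebra.gen, FreeStarAlgebra.monomial_mul, one_mul] at h
    exact h.trans (mul_le_one₀ (pvmSeminorms_gen_le m k hq i)
      (apply_nonneg q.toSeminorm _) hw)

theorem bddAbove_pvmSeminorms (f : FreeStarAlgebra (Fin k × Fin m)) :
    BddAbove (Set.range fun q : pvmSeminorms m k => q.1 f) := by
  suffices h : ∃ C : ℝ, ∀ q : pvmSeminorms m k, q.1 f ≤ C by
    obtain ⟨C, hC⟩ := h
    exact ⟨C, by rintro _ ⟨q, rfl⟩; exact hC q⟩
  induction f using FreeStarAlgebra.induction_monomial with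
  | h0 => exact ⟨0, fun q => (map_zero q.1.toSeminorm).le⟩
  | hadd x y hx hy =>
    obtain ⟨C, hC⟩ := hx
    obtain ⟨D, hD⟩ := hy
    exact ⟨C + D, fun q => (map_add_le_add q.1.toSeminorm x y).trans (add_le_add (hC q) (hD q))⟩
  | hm w c =>
    refine ⟨‖c‖, fun q => ?_⟩
    have h : FreeStarAlgebra.monomial w c = c • FreeStarAlgebra.monomial w 1 := by
      rw [FreeStarAlgebra.smul_monomial, mul_one]
    rw [h, map_smul_eq_mul]
    exact mul_le_of_le_one_right (norm_nonneg _) (pvmSeminorms_monomial_le m k q.2 w)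

/-- The universal C*-seminorm for the relations defining `C*(m,k)`. -/
noncomputable def pvmUniversalSeminorm : CStarSeminorm (FreeStarAlgebra (Fin k × Fin m)) :=
  CStarSeminorm.pointwiseSup (pvmSeminorms m k) (bddAbove_pvmSeminorms m k)

/-- `C*(m,k)`: the universal unital C*-algebra generated by projections `P_{a|x}`
(`a < k`, `x < m`) with `∑ a, P_{a|x} = 1` for every `x`. -/
abbrev UniversalPVM : Type := (pvmUniversalSeminorm m k).Completion

end Universal

/-! ### Quantum tensor and quantum commuting assemblages -/

section Assemblages

open scoped ComplexOrder

/-- `M_n(A)` as a C*-algebra. -/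
noncomputable instance CStarMatrix.cstarAlgebraSquare {n : Type v} [Fintype n] [DecidableEq n]
    {A : Type u} [CStarAlgebra A] : CStarAlgebra (CStarMatrix n n A) :=
  letI := CStarAlgebra.spectralOrder A
  letI := CStarAlgebra.spectralOrderedRing A
  CStarMatrix.instCStarAlgebra

/-- A positive linear functional on a C*-algebra. -/
def IsPositiveFunctional {D : Type u} [CStarAlgebra D] (φ : D →ₗ[ℂ] ℂ) : Prop :=
  ∀ d : D, 0 ≤ φ (star d * d)

/-- A state on a unital C*-algebra: a positive linear functional with `φ 1 = 1`. -/
structure IsState {D : Type u} [CStarAlgebra D] (φ : D →ₗ[ℂ] ℂ) : Prop where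
  positive : IsPositiveFunctional φ
  map_one : φ 1 = 1

/-- A projection-valued measure with `k` outcomes: self-adjoint idempotents that sum up to `1`. -/
structure IsPVM {D : Type u} [CStarAlgebra D] {k : ℕ} (P : Fin k → D) : Prop where
  projection (a : Fin k) : IsStarProjection (P a)
  sum_eq_one : ∑ a, P a = 1

variable (m k : ℕ) (B : Type u) [CStarAlgebra B]

/-- `qA(m,k,B)`, the quantum tensor assemblages: families of positive functionals of the form
`σ_{a|x}(b) = φ (P_{a|x} ⊗ b)` for PVMs in some `B(H)` and a state `φ` on `B(H) ⊗_min B`. -/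
def qA : Set (Fin k → Fin m → (B →ₗ[ℂ] ℂ)) :=
  {σ | (∀ a x, IsPositiveFunctional (σ a x)) ∧
    ∃ (H : Type u) (_ : NormedAddCommGroup H) (_ : InnerProductSpace ℂ H) (_ : CompleteSpace H)
      (φ : MinTensor (H →L[ℂ] H) B →ₗ[ℂ] ℂ) (P : Fin k → Fin m → (H →L[ℂ] H)),
      IsState (D := MinTensor (H →L[ℂ] H) B) φ ∧ (∀ x, IsPVM fun a => P a x) ∧
      ∀ a x b, σ a x b = φ ((minTensorNorm (H →L[ℂ] H) B).toCompletion (P a x ⊗ₜ[ℂ] b))}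

/-- `qcA(m,k,B)`, the quantum commuting assemblages: families of positive functionals of the form
`σ_{a|x}(b) = φ (P_{a|x} b)` for a unital inclusion `ι : B → B(H)`, PVMs in the commutant of `B`
and a state `φ` on `B(H)`. -/
def qcA : Set (Fin k → Fin m → (B →ₗ[ℂ] ℂ)) :=
  {σ | (∀ a x, IsPositiveFunctional (σ a x)) ∧
    ∃ (H : Type u) (_ : NormedAddCommGroup H) (_ : InnerProductSpace ℂ H) (_ : CompleteSpace H)
      (ι : B →⋆ₐ[ℂ] (H →L[ℂ] H)) (P : Fin k → Fin m → (H →L[ℂ] H))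
      (φ : (H →L[ℂ] H) →ₗ[ℂ] ℂ),
      Function.Injective ι ∧ (∀ x, IsPVM fun a => P a x) ∧
      (∀ a x, P a x ∈ Set.centralizer (Set.range ι)) ∧ IsState φ ∧
      ∀ a x b, σ a x b = φ (P a x * ι b)}

end Assemblages

/-! ### Positive functionals, GNS representations and extensions -/

section States

open scoped ComplexOrder InnerProductSpace

variable {A : Type u} [CStarAlgebra A]

/-! Write A = C*(m,k). The inclusion qA ⊆ qcA always holds, because B(H) and D commute inside B(H)
⊗_min D. The content lies in the reverse inclusion.

Suppose the two norms agree on A ⊗ B. They then agree on A ⊗ M_n(B), which is M_n(A ⊗ B) in disguise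
(`IsNuclearPair.norm_le_minTensorNorm_matrix`). A commuting model over D = M_n(B) is a
representation of A ⊗ D together with a state, so it yields a state on A ⊗_min D. A faithful
representation of A on H₁ embeds this algebra into B(H₁) ⊗_min D, and extending the state gives a
tensor model (`qcA_subset_qA_of_norm_le`).

Conversely, approximate by x = ∑ w ⊗ b_w, the sum running over a finite set W of words in the
generators that is closed under deleting the first letter, and take a state ω on A ⊗_max B with ω(x*
x) = ‖x‖²_max. An assemblage only records moments of first order in the projections, whereas ω(x* x)
involves long words. Matrices indexed by W bridge the gap. The state N ↦ r ∑ ω(v* N_{v,w} w) on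
matrices over A ⊗_max B induces a commuting assemblage over M_W(B), which by hypothesis has a tensor
model (`exists_minTensor_moments`). In the GNS representation of the model's state, with vector Ω,
the first moments already force ‖e_{∅,gw} Ω - p_g e_{∅,w} Ω‖² = 0, since p_g is a projection. By
induction e_{∅,w} Ω = w e_{∅,∅} Ω, whence r ω(x* x) = ‖x e_{∅,∅} Ω‖² ≤ r ‖x‖²_min
(`mul_re_apply_le_of_moments`).

Functoriality and injectivity of the minimal norm rest on a description of that norm by positive
definite matrices of functionals (`IsPosDefFamily.pairing_le`, `minTensorNorm_le_of_pairing`) and on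
the extension of positive functionals. -/

theorem IsPositiveFunctional.apply_nonneg {φ : A →ₗ[ℂ] ℂ} (hφ : IsPositiveFunctional φ)
    [PartialOrder A] [StarOrderedRing A] {a : A} (ha : 0 ≤ a) : 0 ≤ φ a := by
  obtain ⟨b, rfl⟩ := CStarAlgebra.nonneg_iff_eq_star_mul_self.1 ha
  exact hφ b

/-- The GNS representation of a positive functional. -/
theorem IsPositiveFunctional.exists_gns {φ : A →ₗ[ℂ] ℂ} (hφ : IsPositiveFunctional φ) :
    ∃ (H : Type u) (_ : NormedAddCommGroup H) (_ : InnerProductSpace ℂ H) (_ : CompleteSpace H)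
      (π : A →⋆ₐ[ℂ] (H →L[ℂ] H)) (Ω : H), ∀ a, ⟪Ω, π a Ω⟫_ℂ = φ a := by
  let := CStarAlgebra.spectralOrder A
  have := CStarAlgebra.spectralOrderedRing A
  let f : A →ₚ[ℂ] ℂ := PositiveLinearMap.mk₀ φ fun x hx => hφ.apply_nonneg hx
  refine ⟨f.GNS, inferInstance, inferInstance, inferInstance, f.gnsStarAlgHom,
    (f.toPreGNS 1 : f.GNS), fun a => ?_⟩
  have h1 : f.gnsStarAlgHom a (f.toPreGNS 1 : f.GNS) = (f.toPreGNS a : f.GNS) := by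
    change f.gnsNonUnitalStarAlgHom a (f.toPreGNS 1 : f.GNS) = _
    rw [PositiveLinearMap.gnsNonUnitalStarAlgHom_apply_coe]
    simp
  rw [h1, UniformSpace.Completion.inner_coe, PositiveLinearMap.preGNS_inner_def]
  simp [f]
  rfl

theorem inner_rep_eq {H : Type v} [NormedAddCommGroup H] [InnerProductSpace ℂ H] [CompleteSpace H]
    (π : A →⋆ₐ[ℂ] (H →L[ℂ] H)) (ξ η : H) (a b : A) :
    ⟪π a ξ, π b η⟫_ℂ = ⟪ξ, π (star a * b) η⟫_ℂ := by
  rw [map_mul, map_star, ContinuousLinearMap.star_eq_adjoint, mul_apply_eq_comp,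
    ContinuousLinearMap.adjoint_inner_right]

theorem IsPositiveFunctional.apply_star {φ : A →ₗ[ℂ] ℂ} (hφ : IsPositiveFunctional φ) (a : A) :
    φ (star a) = star (φ a) := by
  obtain ⟨H, _, _, _, π, Ω, h⟩ := hφ.exists_gns
  rw [← h, ← h, map_star, ContinuousLinearMap.star_eq_adjoint,
    ContinuousLinearMap.adjoint_inner_right]
  exact (inner_conj_symm _ _).symm

theorem IsPositiveFunctional.re_apply_realPart {φ : A →ₗ[ℂ] ℂ} (hφ : IsPositiveFunctional φ)
    (a : A) : (φ (realPart a : A)).re = (φ a).re := by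
  rw [realPart_apply_coe, LinearMap.map_smul_of_tower, map_add, hφ.apply_star]
  simp
  ring

/-- Injective *-homomorphisms preserve the spectrum of self-adjoint elements, and positivity of such
an element is a condition on its spectrum. -/
theorem nonneg_of_map_nonneg {A₁ : Type v} [CStarAlgebra A₁] [PartialOrder A] [StarOrderedRing A]
    [PartialOrder A₁] [StarOrderedRing A₁] (j : A →⋆ₐ[ℂ] A₁) (hj : Function.Injective j) {a : A}
    (ha : IsSelfAdjoint a) (h : 0 ≤ j a) : 0 ≤ a := by
  rw [nonneg_iff_isSelfAdjoint_and_quasispectrumRestricts,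
    quasispectrumRestricts_iff_spectrumRestricts, SpectrumRestricts.nnreal_iff] at h ⊢
  refine ⟨ha, fun x hx => h.2 x ?_⟩
  rwa [ha.map_spectrum_real j hj]

/-- Positive functionals extend along injective unital *-homomorphisms. -/
theorem IsPositiveFunctional.exists_extension {A₁ : Type v} [CStarAlgebra A₁] (j : A →⋆ₐ[ℂ] A₁)
    (hj : Function.Injective j) {φ : A →ₗ[ℂ] ℂ} (hφ : IsPositiveFunctional φ) :
    ∃ φ₁ : A₁ →ₗ[ℂ] ℂ, IsPositiveFunctional φ₁ ∧ ∀ a, φ₁ (j a) = φ a := by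
  let := CStarAlgebra.spectralOrder A
  have := CStarAlgebra.spectralOrderedRing A
  let := CStarAlgebra.spectralOrder A₁
  have := CStarAlgebra.spectralOrderedRing A₁
  -- The M. Riesz extension theorem is applied to Re φ over ℝ. Only the real part is constrained, so
  -- the cone contains all skew-adjoint elements with both signs.
  let s : PointedCone ℝ A₁ :=
    { carrier := {x | 0 ≤ (realPart x : A₁)}
      add_mem' := fun {x y} hx hy => by
        simp only [Set.mem_ofPred_eq, map_add, AddSubgroup.coe_add] at *
        exact add_nonneg hx hy
      zero_mem' := by simp
      smul_mem' := fun c x hx => by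
        change 0 ≤ (realPart ((c : ℝ) • x) : A₁)
        rw [map_smul]
        exact smul_nonneg c.2 hx }
  have hs : ∀ x, x ∈ s ↔ 0 ≤ (realPart x : A₁) := fun x => Iff.rfl
  let e := LinearEquiv.ofInjective (j.toAlgHom.toLinearMap.restrictScalars ℝ) hj
  have he : ∀ a, (e a : A₁) = j a := fun a => rfl
  let f : A₁ →ₗ.[ℝ] ℝ :=
    { domain := LinearMap.range (j.toAlgHom.toLinearMap.restrictScalars ℝ)
      toFun := (Complex.reLm ∘ₗ φ.restrictScalars ℝ) ∘ₗ e.symm.toLinearMap }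
  have hf : ∀ a, f (e a) = (φ a).re := fun a => by
    change (φ (e.symm (e a))).re = _
    rw [e.symm_apply_apply]
  have hre : ∀ a : A, (realPart (j a) : A₁) = j (realPart a : A) := fun a => by
    have h := LinearMap.map_smul_of_tower j.toAlgHom.toLinearMap (2⁻¹ : ℝ) (a + star a)
    rw [realPart_apply_coe, realPart_apply_coe, ← map_star, ← map_add]
    exact h.symm
  obtain ⟨g, hg, hgs⟩ := riesz_extension s f (fun x hx => by
      obtain ⟨a, rfl⟩ := e.surjective x
      rw [hf]
      rw [hs, he, hre] at hx
      rw [← hφ.re_apply_realPart]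
      exact (Complex.nonneg_iff.1
        (hφ.apply_nonneg (nonneg_of_map_nonneg j hj (realPart a).2 hx))).1)
    -- Cofinality of the domain: adding the scalar ‖Re y‖ to y makes its real part nonnegative.
    (fun y => by
      refine ⟨e (algebraMap ℝ A ‖(realPart y : A₁)‖), ?_⟩
      have h1 : j (algebraMap ℝ A ‖(realPart y : A₁)‖) = algebraMap ℝ A₁ ‖(realPart y : A₁)‖ :=
        (j.restrictScalars ℝ).toAlgHom.commutes _
      rw [hs, he, h1, map_add, AddSubgroup.coe_add,
        (IsSelfAdjoint.algebraMap A₁ (IsSelfAdjoint.all _)).coe_realPart]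
      have := (realPart y).2.neg_algebraMap_norm_le_self
      exact neg_le_iff_add_nonneg'.1 this)
  refine ⟨Module.Dual.extendRCLike g, ?_, fun a => ?_⟩
  · intro d
    rw [Module.Dual.extendRCLike_apply]
    -- The element i d* d and its negative both lie in the cone, so `g` kills it and the
    -- complexification of `g` is real at d* d.
    have h0 : (realPart (Complex.I • (star d * d)) : A₁) = 0 := by
      rw [realPart_I_smul, (IsSelfAdjoint.star_mul_self d).imaginaryPart]
      simp
    have h1 : 0 ≤ g (star d * d) := hgs _ (by
      rw [hs, (IsSelfAdjoint.star_mul_self d).coe_realPart]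
      exact star_mul_self_nonneg d)
    have h2 : 0 ≤ g (Complex.I • (star d * d)) := hgs _ (by rw [hs, h0])
    have h3 : 0 ≤ g (-(Complex.I • (star d * d))) := hgs _ (by
      rw [hs, map_neg, NegMemClass.coe_neg, h0, neg_zero])
    rw [map_neg] at h3
    have h4 : g (Complex.I • (star d * d)) = 0 := le_antisymm (by linarith) h2
    change 0 ≤ (g (star d * d) : ℂ) - Complex.I * (g (Complex.I • (star d * d)) : ℂ)
    rw [h4]
    simpa using h1
  · rw [Module.Dual.extendRCLike_apply]
    have h1 := hg (e a)
    have h2 := hg (e (Complex.I • a))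
    rw [hf, he] at h1 h2
    rw [map_smul j, φ.map_smul] at h2
    change (g (j a) : ℂ) - Complex.I * (g (Complex.I • j a) : ℂ) = _
    rw [h1, h2]
    apply Complex.ext <;> simp

/-- On a nontrivial C*-algebra there is a state that attains the norm at `a`. -/
theorem exists_isState_norm_sq [Nontrivial A] (a : A) :
    ∃ φ : A →ₗ[ℂ] ℂ, IsState φ ∧ φ (star a * a) = (‖a‖ ^ 2 : ℝ) := by
  let := CStarAlgebra.spectralOrder A
  have := CStarAlgebra.spectralOrderedRing A
  have hn : IsStarNormal (star a * a) := (IsSelfAdjoint.star_mul_self a).isStarNormal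
  -- On the commutative C*-algebra generated by a* a, some character takes the spectral value ‖a*
  -- a‖. Characters are positive, so this one extends to all of `A`.
  let b : StarAlgebra.elemental ℂ (star a * a) :=
    ⟨star a * a, StarAlgebra.elemental.self_mem ℂ _⟩
  have hb : ((‖star a * a‖ : ℝ) : ℂ) ∈ spectrum ℂ b := by
    have hc : IsClosed (StarAlgebra.elemental ℂ (star a * a) : Set A) :=
      StarAlgebra.elemental.isClosed ℂ _
    rw [StarSubalgebra.spectrum_eq (hS := hc)]
    exact spectrum.algebraMap_mem ℂ
      (CStarAlgebra.norm_mem_spectrum_of_nonneg (star_mul_self_nonneg a))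
  obtain ⟨χ, hχ⟩ := WeakDual.CharacterSpace.mem_spectrum_iff_exists.1 hb
  have hχs : ∀ d, χ (star d) = star (χ d) := fun d => map_star χ d
  obtain ⟨φ, hφ, h⟩ := IsPositiveFunctional.exists_extension
    (StarAlgebra.elemental ℂ (star a * a)).subtype Subtype.val_injective
    (φ := (WeakDual.CharacterSpace.toAlgHom χ).toLinearMap) (fun d => by
      change 0 ≤ χ (star d * d)
      rw [map_mul, hχs]
      exact star_mul_self_nonneg _)
  refine ⟨φ, ⟨hφ, ?_⟩, ?_⟩
  · exact (h 1).trans (map_one χ)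
  · refine (h b).trans (hχ.trans ?_)
    rw [CStarRing.norm_star_mul_self, sq]

/-! ### Hilbert space direct sums of representations. -/

section DirectSum

variable {ι : Type v} {G : ι → Type w} [∀ i, NormedAddCommGroup (G i)]
  [∀ i, InnerProductSpace ℂ (G i)] [∀ i, CompleteSpace (G i)]

/-- The Hilbert space direct sum of the operators `π i a`. -/
noncomputable def directSumOp (π : ∀ i, A →⋆ₐ[ℂ] (G i →L[ℂ] G i)) (a : A) :
    lp G 2 →L[ℂ] lp G 2 :=
  -- Domination by the ℓ² vector ‖a‖ • f gives both square summability and the operator bound.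
  have hle : ∀ (f : lp G 2) i, ‖π i a (f i)‖ ≤ ‖(((‖a‖ : ℂ) • f : lp G 2) : ∀ i, G i) i‖ :=
    fun f i => by
      rw [lp.coeFn_smul, Pi.smul_apply, norm_smul, Complex.norm_real, norm_norm]
      exact (π i a).le_of_opNorm_le (StarAlgHom_norm_le (π i) a) (f i)
  LinearMap.mkContinuous
    { toFun := fun f => (⟨fun i => π i a (f i), (lp.memℓp ((‖a‖ : ℂ) • f)).mono' (hle f)⟩ : lp G 2)
      map_add' := fun f g => by
        ext i
        simp
        rfl
      map_smul' := fun r f => by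
        ext i
        simp } ‖a‖ fun f =>
    (lp.norm_mono (by norm_num) (y := (‖a‖ : ℂ) • f) (hle f)).trans_eq (by
      rw [norm_smul, Complex.norm_real, norm_norm])

theorem directSumOp_apply (π : ∀ i, A →⋆ₐ[ℂ] (G i →L[ℂ] G i)) (a : A) (f : lp G 2) (i : ι) :
    directSumOp π a f i = π i a (f i) := rfl

/-- The direct sum of a family of representations. -/
noncomputable def directSumRep (π : ∀ i, A →⋆ₐ[ℂ] (G i →L[ℂ] G i)) :
    A →⋆ₐ[ℂ] (lp G 2 →L[ℂ] lp G 2) where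
  toFun := directSumOp π
  map_one' := by
    ext f i
    simp [directSumOp_apply]
  map_mul' a b := by
    ext f i
    simp [directSumOp_apply]
  map_zero' := by
    ext f i
    simp [directSumOp_apply]
  map_add' a b := by
    ext f i
    simp [directSumOp_apply]
  commutes' r := by
    ext f i
    simp [directSumOp_apply, Algebra.algebraMap_eq_smul_one]
  map_star' a := by
    rw [ContinuousLinearMap.star_eq_adjoint, ContinuousLinearMap.eq_adjoint_iff]
    intro f g
    rw [lp.inner_eq_tsum, lp.inner_eq_tsum]
    refine tsum_congr fun i => ?_
    rw [directSumOp_apply, directSumOp_apply, map_star, ContinuousLinearMap.star_eq_adjoint,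
      ContinuousLinearMap.adjoint_inner_left]

end DirectSum

/-- The Gelfand--Naimark theorem. -/
theorem exists_faithful_rep (A : Type u) [CStarAlgebra A] :
    ∃ (H : Type u) (_ : NormedAddCommGroup H) (_ : InnerProductSpace ℂ H) (_ : CompleteSpace H)
      (π : A →⋆ₐ[ℂ] (H →L[ℂ] H)), Function.Injective π := by
  -- One representation for each element, to be summed over the index set `A`, so that the sum stays
  -- in the same universe. The zero algebra has no states and acts on the zero space instead.
  have h : ∀ a : A, ∃ (H : Type u) (_ : NormedAddCommGroup H) (_ : InnerProductSpace ℂ H)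
      (_ : CompleteSpace H) (π : A →⋆ₐ[ℂ] (H →L[ℂ] H)), π a = 0 → a = 0 := fun a => by
    rcases subsingleton_or_nontrivial A with hA | hA
    · exact ⟨PUnit, inferInstance, inferInstance, inferInstance,
        { toFun := fun _ => 0
          map_one' := Subsingleton.elim _ _
          map_mul' := fun _ _ => Subsingleton.elim _ _
          map_zero' := rfl
          map_add' := fun _ _ => Subsingleton.elim _ _
          commutes' := fun _ => Subsingleton.elim _ _
          map_star' := fun _ => Subsingleton.elim _ _ }, fun _ => Subsingleton.elim _ _⟩
    · obtain ⟨φ, hφ, h⟩ := exists_isState_norm_sq a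
      obtain ⟨H, i1, i2, i3, π, Ω, hπ⟩ := hφ.positive.exists_gns
      refine ⟨H, i1, i2, i3, π, fun h0 => ?_⟩
      rw [← hπ, map_mul, h0] at h
      simpa using h.symm
  choose H i1 i2 i3 π hπ using h
  refine ⟨lp H 2, inferInstance, inferInstance, inferInstance, directSumRep π, ?_⟩
  rw [injective_iff_map_eq_zero]
  intro a ha
  refine hπ a (ContinuousLinearMap.ext fun ξ => ?_)
  classical
  have h1 := congrArg (fun T : lp H 2 →L[ℂ] lp H 2 => T (lp.single 2 a ξ) a) ha
  have h2 : directSumRep π a (lp.single 2 a ξ) a = π a a (lp.single 2 a ξ a) := rfl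
  rw [lp.single_apply_self] at h2
  exact h2.symm.trans h1

end States

/-! ### Matrices over C*-algebras -/

section Matrices

variable {ι : Type} [DecidableEq ι]

namespace CStarMatrix

section Algebraic

variable {A : Type u} [CStarAlgebra A]

/-- The matrix with the single entry `a` in position `(i, j)`. -/
def entry (i j : ι) (a : A) : CStarMatrix ι ι A := ofMatrix (Matrix.single i j a)

theorem entry_apply (i j k l : ι) (a : A) :
    entry i j a k l = if i = k ∧ j = l then a else 0 := rfl

theorem star_entry (i j : ι) (a : A) : star (entry i j a) = entry j i (star a) :=
  Matrix.conjTranspose_single i j a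

variable [Fintype ι]

theorem entry_mul_entry (i j k l : ι) (a b : A) :
    entry i j a * entry k l b = if j = k then entry i l (a * b) else 0 := by
  split_ifs with h
  · subst h
    exact Matrix.single_mul_single_same a i j l b
  · exact Matrix.single_mul_single_of_ne (h := h) ..

theorem eq_sum_entry (M : CStarMatrix ι ι A) : M = ∑ i, ∑ j, entry i j (M i j) :=
  Matrix.matrix_eq_sum_single M

/-- The constant diagonal matrices. -/
def diagHom : A →⋆ₐ[ℂ] CStarMatrix ι ι A where
  toFun a := ofMatrix (Matrix.diagonal fun _ => a)
  map_one' := Matrix.diagonal_one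
  map_mul' a b := (Matrix.diagonal_mul_diagonal (fun _ => a) fun _ => b).symm
  map_zero' := Matrix.diagonal_zero
  map_add' a b := (Matrix.diagonal_add (fun _ => a) fun _ => b).symm
  commutes' r := by
    ext i j
    simp [algebraMap_apply, Matrix.diagonal_apply]
  map_star' a := (Matrix.diagonal_conjTranspose fun _ => a).symm

theorem diagHom_apply (a : A) (i j : ι) : diagHom a i j = if i = j then a else 0 := rfl

theorem diagHom_mul_apply (a : A) (M : CStarMatrix ι ι A) (i j : ι) :
    (diagHom a * M : CStarMatrix ι ι A) i j = a * M i j := by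
  simp [mul_apply, diagHom_apply, ite_mul]

theorem mul_diagHom_apply (a : A) (M : CStarMatrix ι ι A) (i j : ι) :
    (M * diagHom a : CStarMatrix ι ι A) i j = M i j * a := by
  simp [mul_apply, diagHom_apply, mul_ite]

theorem diagHom_mul_entry (i j : ι) (a b : A) :
    diagHom a * entry i j b = (entry i j (a * b) : CStarMatrix ι ι A) := by
  ext k l
  rw [diagHom_mul_apply, entry_apply, entry_apply]
  split_ifs <;> simp

theorem entry_mul_diagHom (i j : ι) (a b : A) :
    entry i j a * diagHom b = (entry i j (a * b) : CStarMatrix ι ι A) := by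
  ext k l
  rw [mul_diagHom_apply, entry_apply, entry_apply]
  split_ifs <;> simp

/-- The entrywise extension of a *-homomorphism to matrices. -/
def mapHom {R : Type v} [CStarAlgebra R] (h : A →⋆ₐ[ℂ] R) :
    CStarMatrix ι ι A →⋆ₐ[ℂ] CStarMatrix ι ι R where
  toFun M := M.map h
  map_one' := by ext i j; simp [one_apply, apply_ite h]
  map_mul' M N := by ext i j; simp [mul_apply]
  map_zero' := by ext i j; simp
  map_add' M N := by ext i j; simp
  commutes' r := by
    ext i j
    simp only [map_apply, algebraMap_apply, apply_ite h, map_zero]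
    rw [AlgHomClass.commutes h r]
  map_star' M := by ext i j; simp [star_apply, map_star h]

theorem mapHom_apply {R : Type v} [CStarAlgebra R] (h : A →⋆ₐ[ℂ] R) (M : CStarMatrix ι ι A)
    (i j : ι) : mapHom h M i j = h (M i j) := rfl

theorem mapHom_injective {R : Type v} [CStarAlgebra R] {h : A →⋆ₐ[ℂ] R}
    (hh : Function.Injective h) : Function.Injective (mapHom (ι := ι) h) :=
  map_injective hh

/-- The homomorphism `M ↦ ∑ i j, h (M i j) * e i j`, for matrix units `e i j` that commute with
the range of `h`. -/
def unitsHom {R : Type v} [CStarAlgebra R] (h : A →⋆ₐ[ℂ] R) (e : ι → ι → R)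
    (mul : ∀ i j k l, e i j * e k l = if j = k then e i l else 0) (one : ∑ i, e i i = 1)
    (star_e : ∀ i j, star (e i j) = e j i) (comm : ∀ a i j, h a * e i j = e i j * h a) :
    CStarMatrix ι ι A →⋆ₐ[ℂ] R where
  toFun M := ∑ i, ∑ j, h (M i j) * e i j
  map_one' := by
    simp [one_apply, apply_ite h, ite_mul, one]
  map_mul' M N := by
    have h1 : ∀ i j k l, h (M i j) * e i j * (h (N k l) * e k l) =
        if j = k then h (M i j * N k l) * e i l else 0 := fun i j k l => by
      rw [mul_assoc, ← mul_assoc (e i j), ← comm, mul_assoc, mul, ← mul_assoc, map_mul]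
      split_ifs <;> simp
    simp only [Finset.sum_mul]
    simp only [Finset.mul_sum, h1, mul_apply, map_sum, Finset.sum_mul]
    refine Finset.sum_congr rfl fun i _ => ?_
    rw [Finset.sum_comm]
    refine Finset.sum_congr rfl fun j _ => ?_
    rw [Finset.sum_comm]
    simp
  map_zero' := by simp
  map_add' M N := by simp [add_mul, Finset.sum_add_distrib]
  commutes' r := by
    simp [algebraMap_apply, apply_ite h, ite_mul, ← Finset.mul_sum, one, AlgHomClass.commutes h r]
  map_star' M := by
    simp only [star_sum, star_mul, star_e, ← map_star, ← comm, star_apply]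
    rw [Finset.sum_comm]

end Algebraic

end CStarMatrix

end Matrices

/-! ### Positive definite families of functionals -/

section PosDef

open scoped ComplexOrder InnerProductSpace

open CStarMatrix

variable {ι : Type} [Fintype ι] {A : Type u} [CStarAlgebra A] {B : Type v} [CStarAlgebra B]

/-- A family of functionals that defines a positive functional on the matrices over `A`. -/
def IsPosDefFamily (s : ι → ι → A →ₗ[ℂ] ℂ) : Prop :=
  ∀ a : ι → A, 0 ≤ ∑ i, ∑ j, s i j (star (a i) * a j)

/-- The functional `M ↦ ∑ i j, s i j (M i j)` on matrices. -/
noncomputable def matrixFunctional [DecidableEq ι] (s : ι → ι → A →ₗ[ℂ] ℂ) :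
    CStarMatrix ι ι A →ₗ[ℂ] ℂ where
  toFun M := ∑ i, ∑ j, s i j (M i j)
  map_add' M N := by simp [Finset.sum_add_distrib]
  map_smul' r M := by simp [Finset.mul_sum]

theorem matrixFunctional_apply [DecidableEq ι] (s : ι → ι → A →ₗ[ℂ] ℂ) (M : CStarMatrix ι ι A) :
    matrixFunctional s M = ∑ i, ∑ j, s i j (M i j) := rfl

theorem matrixFunctional_entry [DecidableEq ι] (s : ι → ι → A →ₗ[ℂ] ℂ) (i j : ι) (a : A) :
    matrixFunctional s (entry i j a) = s i j a := by
  rw [matrixFunctional_apply, Finset.sum_eq_single i, Finset.sum_eq_single j]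
  · simp [entry_apply]
  · intro k _ hk
    simp [entry_apply, hk.symm]
  · simp
  · intro k _ hk
    simp [entry_apply, hk.symm]
  · simp

/-- Each M* M is the sum, over the rows a of M, of the matrices (a_i* a_j). -/
theorem IsPosDefFamily.isPositiveFunctional [DecidableEq ι] {s : ι → ι → A →ₗ[ℂ] ℂ}
    (hs : IsPosDefFamily s) : IsPositiveFunctional (matrixFunctional s) := by
  intro M
  have h : matrixFunctional s (star M * M) = ∑ k, ∑ i, ∑ j, s i j (star (M k i) * M k j) := by
    simp only [matrixFunctional_apply, mul_apply, star_apply, map_sum]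
    symm
    rw [Finset.sum_comm]
    refine Finset.sum_congr rfl fun i _ => ?_
    rw [Finset.sum_comm]
  rw [h]
  exact Finset.sum_nonneg fun k _ => hs (M k)

/-- The matrix (a_i* a_j) is M* M for the M whose only nonzero row is a. -/
theorem IsPositiveFunctional.isPosDefFamily [DecidableEq ι] {S : CStarMatrix ι ι A →ₗ[ℂ] ℂ}
    (hS : IsPositiveFunctional S) {s : ι → ι → A →ₗ[ℂ] ℂ}
    (h : ∀ i j a, s i j a = S (entry i j a)) : IsPosDefFamily s := by
  intro a
  rcases isEmpty_or_nonempty ι with _ | ⟨⟨k⟩⟩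
  · simp
  · have h1 := hS (∑ i, entry k i (a i))
    rw [star_sum, Finset.sum_mul_sum] at h1
    simpa only [star_entry, entry_mul_entry, if_true, map_sum, ← h] using h1

theorem isPosDefFamily_inner {H : Type w} [NormedAddCommGroup H] [InnerProductSpace ℂ H]
    [CompleteSpace H] (π : A →⋆ₐ[ℂ] (H →L[ℂ] H)) (ξ : ι → H) {s : ι → ι → A →ₗ[ℂ] ℂ}
    (h : ∀ i j a, s i j a = ⟪ξ i, π a (ξ j)⟫_ℂ) : IsPosDefFamily s := by
  intro a
  have h1 : ∑ i, ∑ j, s i j (star (a i) * a j) =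
      ⟪∑ i, π (a i) (ξ i), ∑ i, π (a i) (ξ i)⟫_ℂ := by
    simp only [h, sum_inner, inner_sum, inner_rep_eq]
    rw [Finset.sum_comm]
  rw [h1, inner_self_eq_norm_sq_to_K]
  exact (RCLike.ofReal_nonneg (K := ℂ).2 (sq_nonneg ‖∑ i, π (a i) (ξ i)‖)).trans_eq (by simp)

/-- The functional `a ↦ ⟪ξ, π a η⟫`. -/
noncomputable def vectorFunctional {H : Type w} [NormedAddCommGroup H] [InnerProductSpace ℂ H]
    [CompleteSpace H] (π : A →⋆ₐ[ℂ] (H →L[ℂ] H)) (ξ η : H) : A →ₗ[ℂ] ℂ where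
  toFun a := ⟪ξ, π a η⟫_ℂ
  map_add' a b := by simp
  map_smul' r a := by simp

/-- In the GNS representation of the functional on matrices, restrict to the constant diagonals and
take the vectors e_{k,i} Ω for one fixed row k: they work because e_{i,k} diag(a) e_{k,j} is the
matrix with entry a at (i, j). -/
theorem IsPosDefFamily.exists_gns {s : ι → ι → A →ₗ[ℂ] ℂ} (hs : IsPosDefFamily s) :
    ∃ (H : Type u) (_ : NormedAddCommGroup H) (_ : InnerProductSpace ℂ H) (_ : CompleteSpace H)
      (π : A →⋆ₐ[ℂ] (H →L[ℂ] H)) (ξ : ι → H), ∀ i j a, ⟪ξ i, π a (ξ j)⟫_ℂ = s i j a := by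
  classical
  obtain ⟨H, i1, i2, i3, π, Ω, h⟩ := hs.isPositiveFunctional.exists_gns
  refine ⟨H, i1, i2, i3, π.comp diagHom, ?_⟩
  rcases isEmpty_or_nonempty ι with _ | ⟨⟨k⟩⟩
  · exact ⟨isEmptyElim, fun i => isEmptyElim i⟩
  · refine ⟨fun i => π (entry k i 1) Ω, fun i j a => ?_⟩
    rw [StarAlgHom.comp_apply, ← mul_apply_eq_comp, ← map_mul, inner_rep_eq, h,
      diagHom_mul_entry, star_entry, entry_mul_entry, if_pos rfl, matrixFunctional_entry]
    simp

/-- The functional `∑ i j, s i j ⊗ f i j`. -/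
noncomputable def pairing (s : ι → ι → A →ₗ[ℂ] ℂ) (f : ι → ι → B →ₗ[ℂ] ℂ) :
    A ⊗[ℂ] B →ₗ[ℂ] ℂ :=
  ∑ i, ∑ j, LinearMap.mul' ℂ ℂ ∘ₗ TensorProduct.map (s i j) (f i j)

theorem pairing_tmul (s : ι → ι → A →ₗ[ℂ] ℂ) (f : ι → ι → B →ₗ[ℂ] ℂ) (a : A) (b : B) :
    pairing s f (a ⊗ₜ b) = ∑ i, ∑ j, s i j a * f i j b := by
  simp [pairing, LinearMap.sum_apply]

theorem linearMap_tensor_ext {E : Type w} [AddCommGroup E] [Module ℂ E] {f g : A ⊗[ℂ] B →ₗ[ℂ] E}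
    (h : ∀ a b, f (a ⊗ₜ b) = g (a ⊗ₜ b)) (x : A ⊗[ℂ] B) : f x = g x :=
  congrArg (fun k : A ⊗[ℂ] B →ₗ[ℂ] E => k x) (TensorProduct.ext' h)

/-! ### Vector functionals of spatial representations. -/

section MinNorm

variable {H : Type u} {K : Type v} [NormedAddCommGroup H] [InnerProductSpace ℂ H]
  [NormedAddCommGroup K] [InnerProductSpace ℂ K]

noncomputable instance hilbertTensorInner : Inner ℂ (HilbertTensor H K) :=
  InnerProductSpace.toInner

theorem inner_hilbertTmul (x x' : H) (y y' : K) :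
    ⟪hilbertTmul x y, hilbertTmul x' y'⟫_ℂ = ⟪x, x'⟫_ℂ * ⟪y, y'⟫_ℂ :=
  (UniformSpace.Completion.inner_coe (𝕜 := ℂ) (x ⊗ₜ[ℂ] y) (x' ⊗ₜ[ℂ] y')).trans
    (TensorProduct.inner_tmul ..)

variable [CompleteSpace H] [CompleteSpace K]

theorem norm_spatialRep_le (π : A →⋆ₐ[ℂ] (H →L[ℂ] H)) (ρ : B →⋆ₐ[ℂ] (K →L[ℂ] K))
    (x : A ⊗[ℂ] B) : ‖spatialRep π ρ x‖ ≤ minTensorNorm A B x :=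
  le_ciSup (CStarSeminorm.bddAbove_tensor
    {p | ∃ (H : Type u) (_ : NormedAddCommGroup H) (_ : InnerProductSpace ℂ H)
      (_ : CompleteSpace H) (K : Type v) (_ : NormedAddCommGroup K) (_ : InnerProductSpace ℂ K)
      (_ : CompleteSpace K) (π : A →⋆ₐ[ℂ] (H →L[ℂ] H)) (ρ : B →⋆ₐ[ℂ] (K →L[ℂ] K)),
      p = CStarSeminorm.ofHom (spatialRep π ρ)} x)
    ⟨CStarSeminorm.ofHom (spatialRep π ρ), H, _, _, _, K, _, _, _, π, ρ, rfl⟩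

theorem inner_spatialRep_sum (π : A →⋆ₐ[ℂ] (H →L[ℂ] H)) (ρ : B →⋆ₐ[ℂ] (K →L[ℂ] K))
    (ξ : ι → H) (η : ι → K) (x : A ⊗[ℂ] B) :
    ⟪∑ i, hilbertTmul (ξ i) (η i), spatialRep π ρ x (∑ i, hilbertTmul (ξ i) (η i))⟫_ℂ =
      pairing (fun i j => vectorFunctional π (ξ i) (ξ j))
        (fun i j => vectorFunctional ρ (η i) (η j)) x := by
  induction x using TensorProduct.induction_on with
  | zero => simp
  | add x y hx hy =>
    rw [map_add, map_add, _root_.add_apply, inner_add_right, hx, hy]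
  | tmul a b =>
    rw [spatialRep_tmul, pairing_tmul, map_sum, sum_inner]
    refine Finset.sum_congr rfl fun i _ => ?_
    rw [inner_sum]
    refine Finset.sum_congr rfl fun j _ => ?_
    rw [opTensor_tmul, inner_hilbertTmul]
    rfl

theorem re_pairing_eq_norm_sq (π : A →⋆ₐ[ℂ] (H →L[ℂ] H)) (ρ : B →⋆ₐ[ℂ] (K →L[ℂ] K))
    (ξ : ι → H) (η : ι → K) (x : A ⊗[ℂ] B) :
    (pairing (fun i j => vectorFunctional π (ξ i) (ξ j))
        (fun i j => vectorFunctional ρ (η i) (η j)) (star x * x)).re =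
      ‖spatialRep π ρ x (∑ i, hilbertTmul (ξ i) (η i))‖ ^ 2 := by
  rw [← inner_spatialRep_sum, map_mul, map_star, ContinuousLinearMap.star_eq_adjoint,
    mul_apply_eq_comp, ContinuousLinearMap.adjoint_inner_right, inner_self_eq_norm_sq_to_K]
  norm_cast

end MinNorm

/-- By GNS for both families, the pairing is the vector functional of π ⊗ ρ at ∑ ξ_i ⊗ η_i. Together
with the next bound this characterises the minimal norm by functionals alone, so that algebras in
different universes can be compared. -/
theorem IsPosDefFamily.pairing_le {s : ι → ι → A →ₗ[ℂ] ℂ} {f : ι → ι → B →ₗ[ℂ] ℂ}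
    (hs : IsPosDefFamily s) (hf : IsPosDefFamily f) (x : A ⊗[ℂ] B) :
    (pairing s f (star x * x)).re ≤ minTensorNorm A B x ^ 2 * (pairing s f 1).re := by
  obtain ⟨H, _, _, _, π, ξ, hπ⟩ := hs.exists_gns
  obtain ⟨K, _, _, _, ρ, η, hρ⟩ := hf.exists_gns
  obtain rfl : s = fun i j => vectorFunctional π (ξ i) (ξ j) := by
    ext i j a
    exact (hπ i j a).symm
  obtain rfl : f = fun i j => vectorFunctional ρ (η i) (η j) := by
    ext i j a
    exact (hρ i j a).symm
  have h1 := re_pairing_eq_norm_sq π ρ ξ η 1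
  rw [star_one, one_mul, map_one (spatialRep π ρ), one_apply_eq_self] at h1
  rw [re_pairing_eq_norm_sq, h1, ← mul_pow]
  gcongr
  exact (spatialRep π ρ x).le_of_opNorm_le (norm_spatialRep_le π ρ x) _

theorem exists_fin_sum_tmul {E : Type u} {F : Type v} [AddCommGroup E] [Module ℂ E]
    [AddCommGroup F] [Module ℂ F] (z : E ⊗[ℂ] F) :
    ∃ (n : ℕ) (ξ : Fin n → E) (η : Fin n → F), z = ∑ i, ξ i ⊗ₜ[ℂ] η i := by
  obtain ⟨S, hS⟩ := TensorProduct.exists_finset z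
  refine ⟨S.card, fun i => (S.equivFin.symm i).1.1, fun i => (S.equivFin.symm i).1.2, ?_⟩
  rw [hS, ← Finset.sum_coe_sort S fun i => i.1 ⊗ₜ[ℂ] i.2]
  exact (Equiv.sum_comp S.equivFin.symm fun i : S => i.1.1 ⊗ₜ[ℂ] i.1.2).symm

/-- The finite sums ∑ ξ_i ⊗ η_i are dense in the Hilbert tensor product, and on each of them the
hypothesis is the operator bound for π ⊗ ρ. -/
theorem minTensorNorm_le_of_pairing {x : A ⊗[ℂ] B} {C : ℝ} (hC : 0 ≤ C)
    (h : ∀ (n : ℕ) (s : Fin n → Fin n → A →ₗ[ℂ] ℂ) (f : Fin n → Fin n → B →ₗ[ℂ] ℂ),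
      IsPosDefFamily s → IsPosDefFamily f →
        (pairing s f (star x * x)).re ≤ C ^ 2 * (pairing s f 1).re) :
    minTensorNorm A B x ≤ C := by
  refine Real.iSup_le ?_ hC
  rintro ⟨_, H, _, _, _, K, _, _, _, π, ρ, rfl⟩
  refine ContinuousLinearMap.opNorm_le_bound _ hC fun z => ?_
  refine UniformSpace.Completion.induction_on (α := H ⊗[ℂ] K)
    (p := fun z => ‖spatialRep π ρ x z‖ ≤ C * ‖(z : HilbertTensor H K)‖) z
    (isClosed_le (spatialRep π ρ x).continuous.norm
      (continuous_const.mul continuous_norm)) fun z => ?_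
  obtain ⟨n, ξ, η, rfl⟩ := exists_fin_sum_tmul z
  have hz : ((∑ i, ξ i ⊗ₜ[ℂ] η i : H ⊗[ℂ] K) : UniformSpace.Completion (H ⊗[ℂ] K)) =
      (∑ i, hilbertTmul (ξ i) (η i) : HilbertTensor H K) :=
    map_sum (UniformSpace.Completion.toComplL (𝕜 := ℂ) (E := H ⊗[ℂ] K)) _ _
  have h1 := re_pairing_eq_norm_sq π ρ ξ η 1
  rw [star_one, one_mul, map_one (spatialRep π ρ), one_apply_eq_self] at h1
  have h2 := h n _ _ (isPosDefFamily_inner π ξ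
    (s := fun i j => vectorFunctional π (ξ i) (ξ j)) fun _ _ _ => rfl)
    (isPosDefFamily_inner ρ η
      (s := fun i j => vectorFunctional ρ (η i) (η j)) fun _ _ _ => rfl)
  rw [re_pairing_eq_norm_sq, h1, ← mul_pow] at h2
  have h3 := abs_le_of_sq_le_sq' h2 (by positivity)
  have h4 := h3.2
  rw [← hz] at h4
  exact h4

end PosDef

/-! ### Homomorphisms of tensor products -/

section TensorHoms

open scoped ComplexOrder

open CStarMatrix

variable {A : Type*} {B : Type*} [CStarAlgebra A] [CStarAlgebra B]
variable {A₁ : Type*} {B₁ : Type*} [CStarAlgebra A₁] [CStarAlgebra B₁]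

/-- The homomorphism `a ⊗ b ↦ θ a ⊗ j b`. -/
noncomputable def tensorMap (θ : A →⋆ₐ[ℂ] A₁) (j : B →⋆ₐ[ℂ] B₁) : A ⊗[ℂ] B →⋆ₐ[ℂ] A₁ ⊗[ℂ] B₁ where
  __ := Algebra.TensorProduct.map θ.toAlgHom j.toAlgHom
  map_star' x := by
    change Algebra.TensorProduct.map θ.toAlgHom j.toAlgHom (star x) =
      star (Algebra.TensorProduct.map θ.toAlgHom j.toAlgHom x)
    induction x using TensorProduct.induction_on with
    | zero => simp
    | add x y hx hy => rw [star_add, map_add, map_add, hx, hy, star_add]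
    | tmul a b =>
      rw [TensorProduct.star_tmul, Algebra.TensorProduct.map_tmul, Algebra.TensorProduct.map_tmul,
        TensorProduct.star_tmul]
      exact congrArg₂ _ (map_star θ a) (map_star j b)

theorem tensorMap_tmul (θ : A →⋆ₐ[ℂ] A₁) (j : B →⋆ₐ[ℂ] B₁) (a : A) (b : B) :
    tensorMap θ j (a ⊗ₜ b) = θ a ⊗ₜ j b := rfl

variable {D : Type*} [CStarAlgebra D]

/-- The homomorphism `a ⊗ b ↦ π a * ρ b` for homomorphisms with commuting ranges. -/
noncomputable def tensorLift (π : A →⋆ₐ[ℂ] D) (ρ : B →⋆ₐ[ℂ] D) (h : ∀ a b, Commute (π a) (ρ b)) :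
    A ⊗[ℂ] B →⋆ₐ[ℂ] D where
  __ := Algebra.TensorProduct.lift π.toAlgHom ρ.toAlgHom h
  map_star' x := by
    change Algebra.TensorProduct.lift π.toAlgHom ρ.toAlgHom h (star x) =
      star (Algebra.TensorProduct.lift π.toAlgHom ρ.toAlgHom h x)
    induction x using TensorProduct.induction_on with
    | zero => simp
    | add x y hx hy => rw [star_add, map_add, map_add, hx, hy, star_add]
    | tmul a b =>
      rw [TensorProduct.star_tmul, Algebra.TensorProduct.lift_tmul,
        Algebra.TensorProduct.lift_tmul, star_mul]
      have h1 : star (π a) * star (ρ b) = star (ρ b) * star (π a) := by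
        rw [← map_star, ← map_star]
        exact h _ _
      exact (congrArg₂ _ (map_star π a) (map_star ρ b)).trans h1

theorem tensorLift_tmul (π : A →⋆ₐ[ℂ] D) (ρ : B →⋆ₐ[ℂ] D) (h : ∀ a b, Commute (π a) (ρ b))
    (a : A) (b : B) : tensorLift π ρ h (a ⊗ₜ b) = π a * ρ b :=
  Algebra.TensorProduct.lift_tmul π.toAlgHom ρ.toAlgHom h a b

variable {ι : Type} [Fintype ι]

theorem pairing_tensorMap (θ : A →⋆ₐ[ℂ] A₁) (j : B →⋆ₐ[ℂ] B₁) (s : ι → ι → A₁ →ₗ[ℂ] ℂ)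
    (f : ι → ι → B₁ →ₗ[ℂ] ℂ) (x : A ⊗[ℂ] B) :
    pairing s f (tensorMap θ j x) = pairing (fun i k => s i k ∘ₗ θ.toAlgHom.toLinearMap)
      (fun i k => f i k ∘ₗ j.toAlgHom.toLinearMap) x := by
  refine linearMap_tensor_ext (f := pairing s f ∘ₗ (tensorMap θ j).toAlgHom.toLinearMap)
    (fun a b => ?_) x
  change pairing s f (tensorMap θ j (a ⊗ₜ b)) = _
  rw [tensorMap_tmul, pairing_tmul, pairing_tmul]
  rfl

theorem IsPosDefFamily.comp {s : ι → ι → A₁ →ₗ[ℂ] ℂ} (hs : IsPosDefFamily s)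
    (θ : A →⋆ₐ[ℂ] A₁) : IsPosDefFamily fun i k => s i k ∘ₗ θ.toAlgHom.toLinearMap := by
  intro a
  refine (hs fun i => θ (a i)).trans_eq ?_
  simp [map_star θ]

/-- The family is extended as one positive functional on matrices; extending its members separately
would lose joint positivity. -/
theorem IsPosDefFamily.exists_extension {s : ι → ι → A →ₗ[ℂ] ℂ} (hs : IsPosDefFamily s)
    (θ : A →⋆ₐ[ℂ] A₁) (hθ : Function.Injective θ) : ∃ s₁ : ι → ι → A₁ →ₗ[ℂ] ℂ,
    IsPosDefFamily s₁ ∧ (fun i k => s₁ i k ∘ₗ θ.toAlgHom.toLinearMap) = s := by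
  classical
  obtain ⟨S, hS, h⟩ := hs.isPositiveFunctional.exists_extension (mapHom θ) (mapHom_injective hθ)
  let E : ι → ι → A₁ →ₗ[ℂ] CStarMatrix ι ι A₁ := fun i k =>
    { toFun := entry i k
      map_add' := fun a b => Matrix.single_add i k a b
      map_smul' := fun r a => (Matrix.smul_single r i k a).symm }
  refine ⟨fun i k => S ∘ₗ E i k, hS.isPosDefFamily fun _ _ _ => rfl, ?_⟩
  ext i k a
  have h1 : mapHom θ (entry i k a) = entry i k (θ a) := by
    ext l m
    rw [mapHom_apply, entry_apply, entry_apply, apply_ite θ, map_zero]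
  rw [← matrixFunctional_entry s i k a, ← h, h1]
  rfl

/-- The minimal tensor norm is functorial. -/
theorem minTensorNorm_map_le (θ : A →⋆ₐ[ℂ] A₁) (j : B →⋆ₐ[ℂ] B₁) (x : A ⊗[ℂ] B) :
    minTensorNorm A₁ B₁ (tensorMap θ j x) ≤ minTensorNorm A B x := by
  refine minTensorNorm_le_of_pairing (apply_nonneg (minTensorNorm A B).toSeminorm x)
    fun n s f hs hf => ?_
  rw [← map_star, ← map_mul, ← map_one (tensorMap θ j), pairing_tensorMap, pairing_tensorMap]
  exact (hs.comp θ).pairing_le (hf.comp j) x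

/-- The minimal tensor norm is injective. -/
theorem minTensorNorm_map_eq (θ : A →⋆ₐ[ℂ] A₁) (j : B →⋆ₐ[ℂ] B₁) (hθ : Function.Injective θ)
    (hj : Function.Injective j) (x : A ⊗[ℂ] B) :
    minTensorNorm A₁ B₁ (tensorMap θ j x) = minTensorNorm A B x := by
  refine le_antisymm (minTensorNorm_map_le θ j x) ?_
  refine minTensorNorm_le_of_pairing
    (apply_nonneg (minTensorNorm A₁ B₁).toSeminorm (tensorMap θ j x)) fun n s f hs hf => ?_
  obtain ⟨s, hs₁, rfl⟩ := hs.exists_extension θ hθ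
  obtain ⟨f, hf₁, rfl⟩ := hf.exists_extension j hj
  rw [← pairing_tensorMap, ← pairing_tensorMap, map_mul, map_star, map_one (tensorMap θ j)]
  exact hs₁.pairing_le hf₁ _

theorem IsState.isPosDefFamily {φ : A →ₗ[ℂ] ℂ} (hφ : IsState φ) :
    IsPosDefFamily fun _ _ : Unit => φ := fun a => by
  simpa using hφ.positive (a ())

/-- Pair two states that attain the norms of `a` and `b`, as families of size one. With
`CStarSeminorm.apply_tmul_le` this is the cross-norm property. -/
theorem norm_mul_norm_le_minTensorNorm (a : A) (b : B) :
    ‖a‖ * ‖b‖ ≤ minTensorNorm A B (a ⊗ₜ b) := by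
  have h0 : 0 ≤ minTensorNorm A B (a ⊗ₜ b) := apply_nonneg (minTensorNorm A B).toSeminorm _
  rcases subsingleton_or_nontrivial A with _ | _
  · rwa [Subsingleton.elim a 0, norm_zero, zero_mul, ← Subsingleton.elim a 0]
  rcases subsingleton_or_nontrivial B with _ | _
  · rwa [Subsingleton.elim b 0, norm_zero, mul_zero, ← Subsingleton.elim b 0]
  obtain ⟨φ, hφ, ha⟩ := exists_isState_norm_sq a
  obtain ⟨ψ, hψ, hb⟩ := exists_isState_norm_sq b
  have h := hφ.isPosDefFamily.pairing_le hψ.isPosDefFamily (a ⊗ₜ b)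
  rw [TensorProduct.star_tmul, Algebra.TensorProduct.tmul_mul_tmul, pairing_tmul,
    Algebra.TensorProduct.one_def, pairing_tmul] at h
  simp only [Finset.univ_unique, Finset.sum_singleton, ha, hb, hφ.map_one, hψ.map_one] at h
  rw [← Complex.ofReal_mul, Complex.ofReal_re, one_mul, Complex.one_re, mul_one, ← mul_pow] at h
  exact (abs_le_of_sq_le_sq' h h0).2

theorem CStarSeminorm.le_maxTensorNorm (q : CStarSeminorm (A ⊗[ℂ] B)) (x : A ⊗[ℂ] B) :
    q x ≤ maxTensorNorm A B x :=
  le_ciSup (CStarSeminorm.bddAbove_tensor Set.univ x) ⟨q, trivial⟩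

theorem norm_le_maxTensorNorm (f : A ⊗[ℂ] B →⋆ₐ[ℂ] D) (x : A ⊗[ℂ] B) :
    ‖f x‖ ≤ maxTensorNorm A B x :=
  (CStarSeminorm.ofHom f).le_maxTensorNorm x

theorem CStarSeminorm.norm_toCompletion {A : Type*} [Ring A] [StarRing A] [Algebra ℂ A]
    (p : CStarSeminorm A) (a : A) : ‖p.toCompletion a‖ = p a :=
  p.norm_toCompletionAlgHom a

/-! ### Extension of homomorphisms to C*-completions. -/

section CompletionLift

variable {A : Type*} [Ring A] [StarRing A] [Algebra ℂ A]

theorem CStarSeminorm.denseRange_toCompletion (p : CStarSeminorm A) :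
    DenseRange p.toCompletion :=
  UniformSpace.Completion.denseRange_coe (α := p.Carrier)

variable [StarModule ℂ A]

/-- The extension of a bounded *-homomorphism to the completion. -/
theorem CStarSeminorm.exists_lift_completion (p : CStarSeminorm A) (f : A →⋆ₐ[ℂ] D)
    (hf : ∀ a, ‖f a‖ ≤ p a) :
    ∃ F : p.Completion →⋆ₐ[ℂ] D, ∀ a, F (p.toCompletion a) = f a := by
  let f₀ : p.Carrier → D := f
  have hc : UniformContinuous f₀ := by
    have : LipschitzWith 1 f₀ := LipschitzWith.of_dist_le_mul fun a b => by
      rw [dist_eq_norm, dist_eq_norm, NNReal.coe_one, one_mul]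
      exact (congrArg norm (map_sub f a b)).symm.trans_le (hf _)
    exact this.uniformContinuous
  let g : p.Completion → D := UniformSpace.Completion.extension f₀
  have hgc : Continuous g := UniformSpace.Completion.continuous_extension
  have hg : ∀ a : A, g (p.toCompletionAlgHom a) = f a := fun a =>
    UniformSpace.Completion.extension_coe hc a
  refine ⟨{ toFun := g
            map_one' := ?_
            map_mul' := fun x y => ?_
            map_zero' := ?_
            map_add' := fun x y => ?_
            commutes' := fun r => ?_
            map_star' := fun x => ?_ }, hg⟩
  · exact (congrArg g (map_one p.toCompletionAlgHom)).symm.trans ((hg 1).trans (map_one f))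
  · refine p.induction_completion (q := fun x => g (x * y) = g x * g y) x
      (isClosed_eq (hgc.comp (continuous_id.mul continuous_const))
        (hgc.mul continuous_const)) fun a => ?_
    refine p.induction_completion
      (q := fun y => g (p.toCompletionAlgHom a * y) = g (p.toCompletionAlgHom a) * g y) y
      (isClosed_eq (hgc.comp (continuous_const.mul continuous_id))
        (continuous_const.mul hgc)) fun b => ?_
    rw [← map_mul, hg, hg, hg, map_mul]
  · exact (congrArg g (map_zero p.toCompletionAlgHom)).symm.trans ((hg 0).trans (map_zero f))
  · refine p.induction_completion (q := fun x => g (x + y) = g x + g y) x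
      (isClosed_eq (hgc.comp (continuous_id.add continuous_const))
        (hgc.add continuous_const)) fun a => ?_
    refine p.induction_completion
      (q := fun y => g (p.toCompletionAlgHom a + y) = g (p.toCompletionAlgHom a) + g y) y
      (isClosed_eq (hgc.comp (continuous_const.add continuous_id))
        (continuous_const.add hgc)) fun b => ?_
    rw [← map_add, hg, hg, hg, map_add]
  · exact (hg (algebraMap ℂ A r)).trans (AlgHomClass.commutes f r)
  · refine p.induction_completion (q := fun x => g (star x) = star (g x)) x
      (isClosed_eq (hgc.comp p.continuous_star_completion) (continuous_star.comp hgc)) fun a => ?_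
    rw [p.star_toCompletionAlgHom, hg, hg, map_star]

end CompletionLift

end TensorHoms

/-! ### The universal property of `C*(m,k)` -/

section UniversalProperty

namespace FreeStarAlgebra

variable {X : Type u} {D : Type v} [CStarAlgebra D]

/-- The homomorphism on the free *-algebra that sends the generators to self-adjoint elements. -/
theorem exists_lift (P : X → D) (hP : ∀ x, IsSelfAdjoint (P x)) :
    ∃ f : FreeStarAlgebra X →⋆ₐ[ℂ] D, ∀ x, f (gen x) = P x := by
  let f₀ : FreeStarAlgebra X →ₐ[ℂ] D := MonoidAlgebra.lift ℂ D (FreeMonoid X) (FreeMonoid.lift P)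
  have hm : ∀ w c, f₀ (monomial w c) = c • FreeMonoid.lift P w := fun w c =>
    MonoidAlgebra.lift_single _ _ _
  have hw : ∀ w : FreeMonoid X, FreeMonoid.lift P (star w) = star (FreeMonoid.lift P w) := by
    intro w
    induction w using FreeMonoid.inductionOn' with
    | one => simp
    | of_mul x w hw => rw [star_mul, map_mul, map_mul, star_mul, hw]; simp [(hP x).star_eq]
  refine ⟨{ f₀ with map_star' := fun x => ?_ }, fun x => ?_⟩
  · change f₀ (star x) = star (f₀ x)
    induction x using induction_monomial with
    | h0 => simp
    | hadd x y hx hy => rw [star_add, map_add, map_add, hx, hy, star_add]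
    | hm w c => rw [star_monomial, hm, hm, hw, star_smul]
  · change f₀ (gen x) = P x
    rw [gen, hm]
    simp

end FreeStarAlgebra

variable (m k : ℕ)

/-- The generating projections of `C*(m,k)`. -/
noncomputable def pvmGen (a : Fin k) (x : Fin m) : UniversalPVM m k :=
  (pvmUniversalSeminorm m k).toCompletion (FreeStarAlgebra.gen (a, x))

theorem pvmSeminorms_le {q : CStarSeminorm (FreeStarAlgebra (Fin k × Fin m))}
    (hq : q ∈ pvmSeminorms m k) (f : FreeStarAlgebra (Fin k × Fin m)) :
    q f ≤ pvmUniversalSeminorm m k f :=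
  le_ciSup (bddAbove_pvmSeminorms m k f) ⟨q, hq⟩

theorem pvmUniversalSeminorm_mem : pvmUniversalSeminorm m k ∈ pvmSeminorms m k := by
  refine ⟨fun a x => ?_, fun x => ?_⟩
  · refine le_antisymm (Real.iSup_le (fun q => (q.2.1 a x).le) le_rfl)
      (apply_nonneg (pvmUniversalSeminorm m k).toSeminorm _)
  · refine le_antisymm (Real.iSup_le (fun q => (q.2.2 x).le) le_rfl)
      (apply_nonneg (pvmUniversalSeminorm m k).toSeminorm _)

theorem isPVM_pvmGen (x : Fin m) : IsPVM fun a => pvmGen m k a x := by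
  have h := pvmUniversalSeminorm_mem m k
  refine ⟨fun a => ⟨?_, ?_⟩, ?_⟩
  · have h1 := h.1 a x
    rw [← CStarSeminorm.norm_toCompletion, norm_eq_zero, map_sub, map_mul, sub_eq_zero] at h1
    exact h1
  · rw [IsSelfAdjoint, pvmGen, ← map_star, FreeStarAlgebra.star_gen]
  · have h1 := h.2 x
    rw [← CStarSeminorm.norm_toCompletion, norm_eq_zero, map_sub, map_sum, map_one,
      sub_eq_zero] at h1
    exact h1

theorem exists_universalPVM_lift {D : Type u} [CStarAlgebra D] (P : Fin k → Fin m → D)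
    (hP : ∀ x, IsPVM fun a => P a x) :
    ∃ θ : UniversalPVM m k →⋆ₐ[ℂ] D, ∀ a x, θ (pvmGen m k a x) = P a x := by
  obtain ⟨f, hf⟩ := FreeStarAlgebra.exists_lift (fun i : Fin k × Fin m => P i.1 i.2)
    fun i => ((hP i.2).projection i.1).isSelfAdjoint
  -- The seminorm ‖f ·‖ is one of those in the supremum, so `f` is bounded by the universal seminorm
  -- and extends to the completion.
  have hq : CStarSeminorm.ofHom f ∈ pvmSeminorms m k := by
    refine ⟨fun a x => ?_, fun x => ?_⟩
    · rw [CStarSeminorm.ofHom_apply, map_sub, map_mul, hf,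
        ((hP x).projection a).isIdempotentElem.eq, sub_self, norm_zero]
    · rw [CStarSeminorm.ofHom_apply, map_sub, map_sum, map_one]
      simp only [hf]
      rw [(hP x).sum_eq_one, sub_self, norm_zero]
  obtain ⟨θ, hθ⟩ := (pvmUniversalSeminorm m k).exists_lift_completion f
    fun x => pvmSeminorms_le m k hq x
  exact ⟨θ, fun a x => (hθ _).trans (hf _)⟩

/-- The word in the generators of `C*(m,k)`. -/
noncomputable def pvmWord (w : List (Fin k × Fin m)) : UniversalPVM m k :=
  (w.map fun g => pvmGen m k g.1 g.2).prod

theorem toCompletion_mem_span_pvmWord (f : FreeStarAlgebra (Fin k × Fin m)) :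
    (pvmUniversalSeminorm m k).toCompletion f ∈
      Submodule.span ℂ (Set.range (pvmWord m k)) := by
  induction f using FreeStarAlgebra.induction_monomial with
  | h0 => rw [map_zero]; exact Submodule.zero_mem _
  | hadd x y hx hy => rw [map_add]; exact Submodule.add_mem _ hx hy
  | hm w c =>
    have h : ∀ w : FreeMonoid (Fin k × Fin m), (pvmUniversalSeminorm m k).toCompletion
        (FreeStarAlgebra.monomial w 1) = pvmWord m k w.toList := by
      intro w
      induction w using FreeMonoid.inductionOn' with
      | one => exact map_one _
      | of_mul i w hw =>
        rw [← one_mul (1 : ℂ), ← FreeStarAlgebra.monomial_mul, map_mul, hw]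
        rfl
    rw [← mul_one c, ← FreeStarAlgebra.smul_monomial, map_smul, h]
    exact Submodule.smul_mem _ _ (Submodule.subset_span ⟨_, rfl⟩)

theorem exists_mem_span_pvmWord_norm_sub_lt (a : UniversalPVM m k) {ε : ℝ} (hε : 0 < ε) :
    ∃ a' ∈ Submodule.span ℂ (Set.range (pvmWord m k)), ‖a - a'‖ < ε := by
  obtain ⟨f, hf⟩ := (pvmUniversalSeminorm m k).denseRange_toCompletion.exists_dist_lt a hε
  exact ⟨_, toCompletion_mem_span_pvmWord m k f, by rwa [← dist_eq_norm]⟩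

end UniversalProperty

/-! ### Amplification of nuclear pairs -/

section Amplification

open CStarMatrix

variable {A : Type u} {B : Type v} [CStarAlgebra A] [CStarAlgebra B] {ι : Type} [Fintype ι]
  [DecidableEq ι]

theorem minTensorNorm_le_maxTensorNorm (x : A ⊗[ℂ] B) :
    minTensorNorm A B x ≤ maxTensorNorm A B x :=
  (minTensorNorm A B).le_maxTensorNorm x

theorem CStarMatrix.sum_entry_self : ∑ i, entry i i 1 = (1 : CStarMatrix ι ι B) := by
  conv_rhs => rw [eq_sum_entry (1 : CStarMatrix ι ι B)]
  refine Finset.sum_congr rfl fun i _ => ?_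
  rw [Finset.sum_eq_single i]
  · rw [one_apply_eq]
  · intro j _ hj
    rw [one_apply_ne hj.symm]
    exact Matrix.single_zero i j
  · simp

/-- Every *-homomorphism on `A ⊗ M_n(B)` is determined by its values on `A ⊗ B` and the matrix
units. -/
theorem exists_matrix_lift {D : Type w} [CStarAlgebra D] (p : CStarSeminorm (A ⊗[ℂ] B))
    (f : A ⊗[ℂ] CStarMatrix ι ι B →⋆ₐ[ℂ] D)
    (hf : ∀ x, ‖f (tensorMap (StarAlgHom.id ℂ A) diagHom x)‖ ≤ p x) :
    ∃ (h : p.Completion →⋆ₐ[ℂ] D) (F : CStarMatrix ι ι p.Completion →⋆ₐ[ℂ] D),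
      (∀ x, h (p.toCompletion x) = f (tensorMap (StarAlgHom.id ℂ A) diagHom x)) ∧
      (∀ M, F M = ∑ i, ∑ j, h (M i j) * f (1 ⊗ₜ entry i j 1)) ∧
      (∀ z i j, h z * f (1 ⊗ₜ entry i j 1) = f (1 ⊗ₜ entry i j 1) * h z) ∧
      ∀ a d, F (ofMatrix fun i j => p.toCompletion (a ⊗ₜ d i j)) = f (a ⊗ₜ d) := by
  obtain ⟨h, hh⟩ := p.exists_lift_completion
    (f.comp (tensorMap (StarAlgHom.id ℂ A) diagHom)) hf
  -- Constant diagonals commute with the scalar matrix units; density carries this over to the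
  -- completion.
  have hcomm : ∀ z i j, h z * f (1 ⊗ₜ entry i j 1) = f (1 ⊗ₜ entry i j 1) * h z := by
    intro z i j
    have hc : Continuous h := AddMonoidHomClass.continuous_of_bound h 1 fun z => by
      rw [one_mul]
      exact StarAlgHom_norm_le h z
    refine p.induction_completion
      (q := fun z => h z * f (1 ⊗ₜ entry i j 1) = f (1 ⊗ₜ entry i j 1) * h z) z
      (isClosed_eq (hc.mul continuous_const) (continuous_const.mul hc)) fun x => ?_
    have h1 : h (p.toCompletionAlgHom x) = f (tensorMap (StarAlgHom.id ℂ A) diagHom x) := hh x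
    rw [h1, ← map_mul, ← map_mul]
    clear h1
    congr 1
    induction x using TensorProduct.induction_on with
    | zero => simp
    | add x y hx hy => rw [map_add, add_mul, mul_add, hx, hy]
    | tmul a b =>
      rw [tensorMap_tmul, Algebra.TensorProduct.tmul_mul_tmul,
        Algebra.TensorProduct.tmul_mul_tmul, diagHom_mul_entry, entry_mul_diagHom]
      simp
  refine ⟨h, unitsHom h (fun i j => f (1 ⊗ₜ entry i j 1)) ?_ ?_ ?_ hcomm, hh, fun M => rfl,
    hcomm, fun a d => ?_⟩
  · intro i j k l
    rw [← map_mul, Algebra.TensorProduct.tmul_mul_tmul, entry_mul_entry]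
    split_ifs <;> simp
  · rw [← map_sum, ← TensorProduct.tmul_sum]
    rw [sum_entry_self]
    exact f.map_one'
  · intro i j
    rw [← map_star, TensorProduct.star_tmul, star_entry, star_one, star_one]
  · change ∑ i, ∑ j, h (p.toCompletion (a ⊗ₜ d i j)) * f (1 ⊗ₜ entry i j 1) = _
    conv_rhs => rw [eq_sum_entry d]
    simp only [TensorProduct.tmul_sum, map_sum]
    refine Finset.sum_congr rfl fun i _ => Finset.sum_congr rfl fun j _ => ?_
    rw [hh, StarAlgHom.comp_apply, ← map_mul, tensorMap_tmul,
      Algebra.TensorProduct.tmul_mul_tmul, diagHom_mul_entry, mul_one, mul_one]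
    rfl

/-- If the maximal and minimal norms agree on `A ⊗ B`, then they agree on `A ⊗ M_n(B)`. -/
theorem IsNuclearPair.norm_le_minTensorNorm_matrix (hAB : IsNuclearPair A B) {D : Type w}
    [CStarAlgebra D] (f : A ⊗[ℂ] CStarMatrix ι ι B →⋆ₐ[ℂ] D) (y : A ⊗[ℂ] CStarMatrix ι ι B) :
    ‖f y‖ ≤ minTensorNorm A (CStarMatrix ι ι B) y := by
  let p := minTensorNorm A B
  have hp : maxTensorNorm A B = p := hAB
  obtain ⟨-, F, -, -, -, hF⟩ := exists_matrix_lift p f fun x => by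
    rw [← hp]
    exact norm_le_maxTensorNorm (f.comp (tensorMap (StarAlgHom.id ℂ A) diagHom)) x
  let g := (minTensorNorm A (CStarMatrix ι ι B)).toCompletion
  have hg : ∀ y, ‖g y‖ = minTensorNorm A (CStarMatrix ι ι B) y := CStarSeminorm.norm_toCompletion _
  obtain ⟨h, G, hh, hG, hcomm, hG'⟩ := exists_matrix_lift p g fun x => by
    rw [hg]
    exact minTensorNorm_map_le _ _ x
  -- An injective `G` is isometric, so for M corresponding to `y` one gets ‖f y‖ = ‖F M‖ ≤ ‖M‖ = ‖G
  -- M‖ = ‖g y‖, which is the minimal norm of `y`.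
  have hGinj : Function.Injective G := by
    rw [injective_iff_map_eq_zero]
    intro M hM
    ext k l
    have hdiag : Function.Injective (diagHom : B →⋆ₐ[ℂ] CStarMatrix ι ι B) := fun a b hab => by
      simpa [diagHom_apply] using congrArg (fun N : CStarMatrix ι ι B => N k k) hab
    -- Injectivity of the minimal norm along the diagonal embedding of `B`.
    have hn : ∀ z, ‖h z‖ = ‖z‖ := fun z => by
      have hc : Continuous h := AddMonoidHomClass.continuous_of_bound h 1 fun z => by
        rw [one_mul]
        exact StarAlgHom_norm_le h z
      refine p.induction_completion (q := fun z => ‖h z‖ = ‖z‖) z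
        (isClosed_eq hc.norm continuous_norm) fun x => ?_
      refine (congrArg norm (hh x)).trans ?_
      rw [hg, minTensorNorm_map_eq _ _ Function.injective_id hdiag]
      exact (p.norm_toCompletion x).symm
    have he : ∀ i j r s, g (1 ⊗ₜ entry i j 1) * g (1 ⊗ₜ entry r s 1) =
        if j = r then g (1 ⊗ₜ entry i s 1) else 0 := by
      intro i j r s
      rw [← map_mul, Algebra.TensorProduct.tmul_mul_tmul, entry_mul_entry]
      split_ifs <;> simp
    -- Compressing by matrix units isolates one entry of M; summing over r then removes the factor
    -- e_{r,r}.
    have h1 : ∀ r, g (1 ⊗ₜ entry r k 1) * G M * g (1 ⊗ₜ entry l r 1) =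
        h (M k l) * g (1 ⊗ₜ entry r r 1) := by
      intro r
      have h2 : ∀ i j, g (1 ⊗ₜ entry r k 1) * (h (M i j) * g (1 ⊗ₜ entry i j 1)) *
          g (1 ⊗ₜ entry l r 1) = if k = i then
            (if j = l then h (M i j) * g (1 ⊗ₜ entry r r 1) else 0) else 0 := by
        intro i j
        rw [← mul_assoc, ← hcomm, mul_assoc, mul_assoc, he]
        by_cases h3 : j = l
        · rw [if_pos h3, if_pos h3, he, mul_ite, mul_zero]
        · rw [if_neg h3, if_neg h3, mul_zero, mul_zero, ite_self]
      rw [hG]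
      simp only [Finset.mul_sum, Finset.sum_mul, h2]
      simp
    have h2 : h (M k l) = 0 := by
      have h3 : ∑ r, g (1 ⊗ₜ entry r r 1) = 1 := by
        rw [← map_sum, ← TensorProduct.tmul_sum, sum_entry_self]
        exact g.map_one'
      rw [← mul_one (h (M k l)), ← h3, Finset.mul_sum]
      refine Finset.sum_eq_zero fun r _ => ?_
      rw [← h1, hM, mul_zero, zero_mul]
    change M k l = 0
    rw [← norm_eq_zero, ← hn, h2, norm_zero]
  obtain ⟨M, hM₁, hM₂⟩ : ∃ M, F M = f y ∧ G M = g y := by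
    induction y using TensorProduct.induction_on with
    | zero => exact ⟨0, by simp, by simp⟩
    | add x y hx hy =>
      obtain ⟨M, hM₁, hM₂⟩ := hx
      obtain ⟨N, hN₁, hN₂⟩ := hy
      exact ⟨M + N, by rw [map_add, map_add, hM₁, hN₁], by rw [map_add, map_add, hM₂, hN₂]⟩
    | tmul a d => exact ⟨_, hF a d, hG' a d⟩
  rw [← hM₁, ← hg, ← hM₂, NonUnitalStarAlgHom.norm_map G hGinj]
  exact StarAlgHom_norm_le F M

end Amplification

/-! ### Comparison of quantum tensor and quantum commuting assemblages -/

section Comparison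

open scoped ComplexOrder

theorem IsPVM.map {D : Type u} {E : Type v} [CStarAlgebra D] [CStarAlgebra E] {k : ℕ}
    {P : Fin k → D} (hP : IsPVM P) (f : D →⋆ₐ[ℂ] E) : IsPVM fun a => f (P a) where
  projection a := ⟨by rw [IsIdempotentElem, ← map_mul, (hP.projection a).isIdempotentElem.eq],
    by rw [IsSelfAdjoint, ← map_star, (hP.projection a).isSelfAdjoint.star_eq]⟩
  sum_eq_one := by rw [← map_sum, hP.sum_eq_one, map_one]

theorem IsState.nontrivial {D : Type u} [CStarAlgebra D] {φ : D →ₗ[ℂ] ℂ} (hφ : IsState φ) :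
    Nontrivial D := by
  by_contra h
  rw [not_nontrivial_iff_subsingleton] at h
  have h1 := hφ.map_one
  rw [Subsingleton.elim (1 : D) 0, map_zero] at h1
  exact zero_ne_one h1

theorem IsState.comp {D : Type u} {E : Type v} [CStarAlgebra D] [CStarAlgebra E] {φ : E →ₗ[ℂ] ℂ}
    (hφ : IsState φ) (f : D →⋆ₐ[ℂ] E) : IsState (φ ∘ₗ f.toAlgHom.toLinearMap) where
  positive d := by
    change 0 ≤ φ (f (star d * d))
    rw [map_mul, map_star]
    exact hφ.positive (f d)
  map_one := (congrArg φ (_root_.map_one f)).trans hφ.map_one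

theorem IsState.exists_extension {A : Type u} {A₁ : Type v} [CStarAlgebra A] [CStarAlgebra A₁]
    (j : A →⋆ₐ[ℂ] A₁) (hj : Function.Injective j) {φ : A →ₗ[ℂ] ℂ} (hφ : IsState φ) :
    ∃ φ₁ : A₁ →ₗ[ℂ] ℂ, IsState φ₁ ∧ ∀ a, φ₁ (j a) = φ a := by
  obtain ⟨φ₁, h₁, h₂⟩ := hφ.positive.exists_extension j hj
  exact ⟨φ₁, ⟨h₁, by rw [← _root_.map_one j, h₂, hφ.map_one]⟩, h₂⟩

variable {A : Type u} {B : Type v} [CStarAlgebra A] [CStarAlgebra B]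

/-- The lower cross-norm bound gives ‖b‖ ≤ p (1 ⊗ b), since ‖1‖ = 1 in a nontrivial algebra. It
serves both the minimal and the maximal norm. -/
theorem toCompletion_inclRight_injective [Nontrivial A] (p : CStarSeminorm (A ⊗[ℂ] B))
    (hp : ∀ x, minTensorNorm A B x ≤ p x) :
    Function.Injective (p.toCompletion.comp (tensorInclRight A B)) := by
  rw [injective_iff_map_eq_zero]
  intro b hb
  have h1 : ‖p.toCompletion ((1 : A) ⊗ₜ b)‖ = 0 := by
    rw [norm_eq_zero]
    exact hb
  rw [CStarSeminorm.norm_toCompletion] at h1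
  have h2 := (norm_mul_norm_le_minTensorNorm (1 : A) b).trans (hp _)
  rw [h1, norm_one, one_mul] at h2
  exact norm_le_zero_iff.1 h2

theorem toCompletion_inclLeft_injective [Nontrivial B] :
    Function.Injective ((minTensorNorm A B).toCompletion.comp (tensorInclLeft A B)) := by
  rw [injective_iff_map_eq_zero]
  intro a ha
  have h1 : ‖(minTensorNorm A B).toCompletion (a ⊗ₜ (1 : B))‖ = 0 := by
    rw [norm_eq_zero]
    exact ha
  rw [CStarSeminorm.norm_toCompletion] at h1
  have h2 := norm_mul_norm_le_minTensorNorm a (1 : B)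
  rw [h1, norm_one, mul_one] at h2
  exact norm_le_zero_iff.1 h2

theorem nontrivial_left_of_minTensor [h : Nontrivial (MinTensor A B)] : Nontrivial A := by
  by_contra hA
  rw [not_nontrivial_iff_subsingleton] at hA
  refine zero_ne_one (α := MinTensor A B) ?_
  rw [← map_one (minTensorNorm A B).toCompletion, Algebra.TensorProduct.one_def,
    Subsingleton.elim (1 : A) 0, TensorProduct.zero_tmul, map_zero]

/-- Commuting PVMs in a C*-algebra that contains `D` give quantum commuting assemblages. -/
theorem mem_qcA_of_commute {m k : ℕ} {D E : Type u} [CStarAlgebra D] [CStarAlgebra E]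
    {σ : Fin k → Fin m → (D →ₗ[ℂ] ℂ)} (ι : D →⋆ₐ[ℂ] E) (hι : Function.Injective ι)
    (P : Fin k → Fin m → E) (hP : ∀ x, IsPVM fun a => P a x)
    (hPι : ∀ a x d, Commute (P a x) (ι d)) {φ : E →ₗ[ℂ] ℂ} (hφ : IsState φ)
    (hσ : ∀ a x d, σ a x d = φ (P a x * ι d)) : σ ∈ qcA m k D := by
  obtain ⟨L, _, _, _, κ, hκ⟩ := exists_faithful_rep E
  obtain ⟨φ₁, hφ₁, hφ₁'⟩ := hφ.exists_extension κ hκ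
  refine ⟨fun a x d => ?_, L, _, _, _, κ.comp ι, fun a x => κ (P a x), φ₁, hκ.comp hι,
    fun x => (hP x).map κ, fun a x => ?_, hφ₁, fun a x d => ?_⟩
  · have h1 : star (P a x * ι d) * (P a x * ι d) = P a x * ι (star d * d) := by
      have hp := (hP x).projection a
      rw [(hPι a x d).eq, star_mul, hp.isSelfAdjoint.star_eq, ← (hPι a x d).eq, mul_assoc,
        ← mul_assoc (star (ι d)), ← map_star, ← (hPι a x (star d)).eq, mul_assoc, ← mul_assoc,
        hp.isIdempotentElem.eq, map_mul]
    rw [hσ, ← h1]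
    exact hφ.positive _
  · rintro _ ⟨d, rfl⟩
    change κ (ι d) * κ (P a x) = κ (P a x) * κ (ι d)
    rw [← map_mul, ← map_mul, (hPι a x d).eq]
  · rw [StarAlgHom.comp_apply, ← map_mul, hφ₁', hσ]

/-- The two legs of B(H) ⊗_min D commute. The leg of `D` is faithful because the existence of a
state excludes B(H) = 0. -/
theorem qA_subset_qcA (m k : ℕ) (D : Type u) [CStarAlgebra D] : qA m k D ⊆ qcA m k D := by
  rintro σ ⟨-, H, _, _, _, φ, P, hφ, hP, hσφ⟩
  have := hφ.nontrivial
  have : Nontrivial (H →L[ℂ] H) := nontrivial_left_of_minTensor (B := D)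
  let τ := (minTensorNorm (H →L[ℂ] H) D).toCompletion
  refine mem_qcA_of_commute (τ.comp (tensorInclRight _ _))
    (toCompletion_inclRight_injective _ fun _ => le_rfl)
    (fun a x => τ (tensorInclLeft _ _ (P a x)))
    (fun x => (hP x).map (τ.comp (tensorInclLeft _ _))) (fun a x d => ?_) hφ fun a x d => ?_
  · change τ (P a x ⊗ₜ 1) * τ (1 ⊗ₜ d) = τ (1 ⊗ₜ d) * τ (P a x ⊗ₜ 1)
    rw [← map_mul, ← map_mul]
    simp
  · change σ a x d = φ (τ (P a x ⊗ₜ 1) * τ (1 ⊗ₜ d))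
    rw [← map_mul, hσφ]
    simp [τ]

variable (m k : ℕ)

theorem commute_of_forall_pvmGen {D : Type u} [CStarAlgebra D] (θ : UniversalPVM m k →⋆ₐ[ℂ] D)
    {d : D} (h : ∀ a x, Commute (θ (pvmGen m k a x)) d) (a : UniversalPVM m k) :
    Commute (θ a) d := by
  have hc : Continuous θ := AddMonoidHomClass.continuous_of_bound θ 1 fun z => by
    rw [one_mul]
    exact StarAlgHom_norm_le θ z
  refine (pvmUniversalSeminorm m k).induction_completion (q := fun a => Commute (θ a) d) a
    (isClosed_eq (hc.mul continuous_const) (continuous_const.mul hc)) fun f => ?_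
  have hf := toCompletion_mem_span_pvmWord m k f
  change Commute (θ ((pvmUniversalSeminorm m k).toCompletion f)) d
  refine Submodule.span_induction (p := fun a _ => Commute (θ a) d) ?_ ?_ ?_ ?_ hf
  · rintro _ ⟨w, rfl⟩
    induction w with
    | nil =>
      rw [pvmWord, List.map_nil, List.prod_nil, map_one]
      exact Commute.one_left d
    | cons g w hw =>
      rw [pvmWord, List.map_cons, List.prod_cons, map_mul]
      exact (h g.1 g.2).mul_left hw
  · rw [map_zero]
    exact Commute.zero_left d
  · intro x y _ _ hx hy
    rw [map_add]
    exact hx.add_left hy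
  · intro r x _ hx
    rw [map_smul]
    exact hx.smul_left r

/-- The norm bound lets the commuting representation factor through the minimal tensor product; the
rest is a transfer of the state along an embedding into B(H₁) ⊗_min D. -/
theorem qcA_subset_qA_of_norm_le {D : Type u} [CStarAlgebra D]
    (h : ∀ (H : Type u) [NormedAddCommGroup H] [InnerProductSpace ℂ H] [CompleteSpace H]
      (f : UniversalPVM m k ⊗[ℂ] D →⋆ₐ[ℂ] (H →L[ℂ] H)) (y : UniversalPVM m k ⊗[ℂ] D),
      ‖f y‖ ≤ minTensorNorm (UniversalPVM m k) D y) : qcA m k D ⊆ qA m k D := by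
  rintro σ ⟨hσ, H, _, _, _, ι, P, φ, hι, hP, hPι, hφ, hσφ⟩
  refine ⟨hσ, ?_⟩
  have := hφ.nontrivial
  have : Nontrivial D := by
    by_contra hD
    rw [not_nontrivial_iff_subsingleton] at hD
    refine zero_ne_one (α := H →L[ℂ] H) ?_
    rw [← map_one ι, Subsingleton.elim (1 : D) 0, map_zero]
  obtain ⟨θ₀, hθ₀⟩ := exists_universalPVM_lift m k P hP
  have hcomm : ∀ a d, Commute (θ₀ a) (ι d) := fun a d =>
    commute_of_forall_pvmGen m k θ₀ (fun b x => by
      rw [hθ₀]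
      exact (hPι b x (ι d) ⟨d, rfl⟩).symm) a
  let W := minTensorNorm (UniversalPVM m k) D
  obtain ⟨ψ, hψ⟩ := W.exists_lift_completion (tensorLift θ₀ ι hcomm) (h H _)
  -- Representing the whole tensor product, rather than C*(m,k) alone, puts the Hilbert space in the
  -- universe that `qA` requires.
  obtain ⟨H₁, _, _, _, κ, hκ⟩ := exists_faithful_rep (MinTensor (UniversalPVM m k) D)
  let θ := κ.comp (W.toCompletion.comp (tensorInclLeft (UniversalPVM m k) D))
  have hθ : Function.Injective θ := hκ.comp toCompletion_inclLeft_injective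
  let W₁ := minTensorNorm (H₁ →L[ℂ] H₁) D
  have hJ₀ : ∀ y, ‖W₁.toCompletion (tensorMap θ (StarAlgHom.id ℂ D) y)‖ = W y := fun y => by
    rw [CStarSeminorm.norm_toCompletion]
    exact minTensorNorm_map_eq θ _ hθ Function.injective_id y
  obtain ⟨J, hJ⟩ := W.exists_lift_completion
    (W₁.toCompletion.comp (tensorMap θ (StarAlgHom.id ℂ D))) fun y => (hJ₀ y).le
  have hJn : ∀ z, ‖J z‖ = ‖z‖ := fun z => by
    have hc : Continuous J := AddMonoidHomClass.continuous_of_bound J 1 fun z => by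
      rw [one_mul]
      exact StarAlgHom_norm_le J z
    refine W.induction_completion (q := fun z => ‖J z‖ = ‖z‖) z
      (isClosed_eq hc.norm continuous_norm) fun y => ?_
    exact (congrArg norm (hJ y)).trans ((hJ₀ y).trans (W.norm_toCompletion y).symm)
  have hJi : Function.Injective J := by
    rw [injective_iff_map_eq_zero]
    intro z hz
    rw [← norm_eq_zero, ← hJn, hz, norm_zero]
  -- The pulled-back state lives only on the image of `J` and has to be extended to all of B(H₁)
  -- ⊗_min D.
  obtain ⟨Φ, hΦ, hΦJ⟩ := (hφ.comp ψ).exists_extension J hJi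
  refine ⟨H₁, _, _, _, Φ, fun a x => θ (pvmGen m k a x), hΦ, fun x => (isPVM_pvmGen m k x).map θ,
    fun a x d => ?_⟩
  have h1 : J (W.toCompletion (pvmGen m k a x ⊗ₜ d)) =
      W₁.toCompletion (θ (pvmGen m k a x) ⊗ₜ d) := hJ _
  refine Eq.trans ?_ (congrArg Φ h1)
  rw [hΦJ, hσφ]
  change _ = φ (ψ (W.toCompletion (pvmGen m k a x ⊗ₜ d)))
  rw [hψ, tensorLift_tmul, hθ₀]

theorem IsNuclearPair.qA_eq_qcA {B : Type u} [CStarAlgebra B]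
    (hB : IsNuclearPair (UniversalPVM m k) B) (n : ℕ) :
    qA m k (CStarMatrix (Fin n) (Fin n) B) = qcA m k (CStarMatrix (Fin n) (Fin n) B) :=
  (qA_subset_qcA m k _).antisymm
    (qcA_subset_qA_of_norm_le m k fun _ _ _ _ f y => hB.norm_le_minTensorNorm_matrix f y)

end Comparison

/-! ### From equality of assemblages to nuclear pairs -/

section Moments

open scoped ComplexOrder InnerProductSpace

variable {A B A₁ M : Type*} [CStarAlgebra A] [CStarAlgebra B] [CStarAlgebra A₁] [CStarAlgebra M]
  {ι X : Type*} [Fintype ι] {G : Type*} [NormedAddCommGroup G] [InnerProductSpace ℂ G]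
  [CompleteSpace G]

/-- A representation of `A₁ ⊗ M` with a vector that reproduces the moments of `μ` of order one in
the projections `p` controls `μ` on all the words in `p`. -/
theorem mul_re_apply_le_of_moments {p : X → A} (hp : ∀ g, IsStarProjection (p g))
    (θ : A →⋆ₐ[ℂ] A₁) (δ : B →⋆ₐ[ℂ] M) (e : ι → ι → B → M)
    (star_e : ∀ i j b, star (e i j b) = e j i (star b))
    (e_mul : ∀ i j l b c, e i j b * e j l c = e i l (b * c))
    (δ_mul_e : ∀ i j b c, δ b * e i j c = e i j (b * c))
    (π : A₁ ⊗[ℂ] M →⋆ₐ[ℂ] (G →L[ℂ] G)) (Ω : G)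
    (μ : A ⊗[ℂ] B →ₗ[ℂ] ℂ) (r : ℝ)
    (v : ι → List X) (hv : Function.Injective v)
    (htail : ∀ i g w, v i = g :: w → ∃ j, v j = w) (i₀ : ι) (hi₀ : v i₀ = [])
    (h1 : ∀ i j b, ⟪Ω, π (1 ⊗ₜ e i j b) Ω⟫_ℂ =
      r * μ ((star ((v i).map p).prod * ((v j).map p).prod) ⊗ₜ b))
    (h2 : ∀ g i j, ⟪Ω, π (θ (p g) ⊗ₜ e i j 1) Ω⟫_ℂ =
      r * μ ((star ((v i).map p).prod * (p g * ((v j).map p).prod)) ⊗ₜ 1))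
    (b : ι → B) {x : A ⊗[ℂ] B} (hx : x = ∑ i, ((v i).map p).prod ⊗ₜ b i) :
    r * (μ (star x * x)).re ≤ ‖π (tensorMap θ δ x)‖ ^ 2 * (r * (μ 1).re) := by
  have hin : ∀ y z, ⟪π y Ω, π z Ω⟫_ℂ = ⟪Ω, π (star y * z) Ω⟫_ℂ := fun y z => by
    rw [map_mul, map_star, mul_apply_eq_comp, ContinuousLinearMap.star_eq_adjoint,
      ContinuousLinearMap.adjoint_inner_right]
  -- Expand the squared norm of the difference. As θ(p_g) is idempotent, all four terms are of order
  -- at most one in it, so `h1` and `h2` evaluate each of them, up to sign, to r μ(w* p_g w ⊗ 1)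
  -- with w the word of `v i`.
  have hstep : ∀ i j g, v j = g :: v i →
      π (1 ⊗ₜ e i₀ j 1) Ω = π (θ (p g) ⊗ₜ e i₀ i 1) Ω := by
    intro i j g hg
    have hq : IsStarProjection (θ (p g)) := (hp g).map θ
    rw [← sub_eq_zero, ← inner_self_eq_zero (𝕜 := ℂ), inner_sub_left, inner_sub_right,
      inner_sub_right, hin, hin, hin, hin]
    simp only [TensorProduct.star_tmul, Algebra.TensorProduct.tmul_mul_tmul, star_e,
      e_mul, star_one, one_mul, mul_one, hq.isSelfAdjoint.star_eq,
      hq.isIdempotentElem.eq, h1, h2, hg, List.map_cons, List.prod_cons, star_mul,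
      (hp g).isSelfAdjoint.star_eq, mul_assoc]
    have hq' : ∀ z, p g * (p g * z) = p g * z :=
      fun z => by rw [← mul_assoc, (hp g).isIdempotentElem.eq]
    simp only [hq']
    ring
  -- Letters are peeled off from the left; this is where closure of the index set under tails
  -- enters.
  have hword : ∀ w i, v i = w → π (1 ⊗ₜ e i₀ i 1) Ω = π (θ (w.map p).prod ⊗ₜ e i₀ i₀ 1) Ω := by
    intro w
    induction w with
    | nil =>
      intro i hi
      rw [hv (hi.trans hi₀.symm), List.map_nil, List.prod_nil, map_one]
    | cons g w hw =>
      intro j hj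
      obtain ⟨i, hi⟩ := htail j g w hj
      have h3 : ∀ i, π (θ (p g) ⊗ₜ e i₀ i 1) = π (θ (p g) ⊗ₜ 1) * π (1 ⊗ₜ e i₀ i 1) := fun i => by
        rw [← map_mul, Algebra.TensorProduct.tmul_mul_tmul, one_mul, mul_one]
      rw [hstep i j g (by rw [hj, hi]), h3, mul_apply_eq_comp, hw i hi,
        ← mul_apply_eq_comp, ← map_mul, Algebra.TensorProduct.tmul_mul_tmul, one_mul,
        List.map_cons, List.prod_cons, map_mul]
  -- The left side has squared norm r μ(x* x) by first moments alone. The right side applies the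
  -- image of x to a vector of squared norm r μ(1).
  have hX : π (∑ i, 1 ⊗ₜ e i₀ i (b i)) Ω = π (tensorMap θ δ x) (π (1 ⊗ₜ e i₀ i₀ 1) Ω) := by
    have h3 : ∀ i, π (1 ⊗ₜ e i₀ i (b i)) Ω =
        π (θ ((v i).map p).prod ⊗ₜ δ (b i)) (π (1 ⊗ₜ e i₀ i₀ 1) Ω) := fun i => by
      have h4 : π (1 ⊗ₜ e i₀ i (b i)) = π (1 ⊗ₜ δ (b i)) * π (1 ⊗ₜ e i₀ i 1) := by
        rw [← map_mul, Algebra.TensorProduct.tmul_mul_tmul, one_mul, δ_mul_e, mul_one]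
      rw [h4, mul_apply_eq_comp, hword _ i rfl, ← mul_apply_eq_comp,
        ← mul_apply_eq_comp, ← map_mul, ← map_mul,
        Algebra.TensorProduct.tmul_mul_tmul, Algebra.TensorProduct.tmul_mul_tmul, one_mul, mul_one]
    have h5 : ∀ T : ι → G →L[ℂ] G, ∀ ξ, (∑ i, T i) ξ = ∑ i, T i ξ := fun T ξ => by simp
    rw [hx]
    simp only [map_sum, tensorMap_tmul]
    rw [h5, h5]
    exact Finset.sum_congr rfl fun i _ => h3 i
  have hnorm : ∀ {ξ : G} {z : ℂ}, ⟪ξ, ξ⟫_ℂ = r * z → ‖ξ‖ ^ 2 = r * z.re := fun {ξ z} h => by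
    rw [inner_self_eq_norm_sq_to_K] at h
    have h4 := congrArg Complex.re h
    rw [Complex.re_ofReal_mul] at h4
    rw [← h4]
    norm_cast
  have hl : ‖π (∑ i, 1 ⊗ₜ e i₀ i (b i)) Ω‖ ^ 2 = r * (μ (star x * x)).re := by
    refine hnorm ?_
    rw [hin, hx, star_sum, star_sum, Finset.sum_mul_sum, Finset.sum_mul_sum]
    simp only [TensorProduct.star_tmul, Algebra.TensorProduct.tmul_mul_tmul, star_e,
      e_mul, star_one, one_mul, map_sum, Finset.mul_sum]
    simp [h1]
  have hr' : ‖π (1 ⊗ₜ e i₀ i₀ 1) Ω‖ ^ 2 = r * (μ 1).re := by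
    refine hnorm ?_
    rw [hin]
    simp only [TensorProduct.star_tmul, Algebra.TensorProduct.tmul_mul_tmul, star_e,
      e_mul, star_one, one_mul, h1, hi₀]
    simp [Algebra.TensorProduct.one_def]
  have h3 := (π (tensorMap θ δ x)).le_opNorm (π (1 ⊗ₜ e i₀ i₀ 1) Ω)
  rw [← hX] at h3
  have h4 := pow_le_pow_left₀ (norm_nonneg _) h3 2
  rwa [mul_pow, hl, hr'] at h4

end Moments

/-! ### The commuting assemblage attached to a finite set of words. -/

section Converse

open scoped ComplexOrder InnerProductSpace

open CStarMatrix

theorem norm_comp_toCompletion_le {T : Type u} [Ring T] [StarRing T] [Algebra ℂ T]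
    [StarModule ℂ T] (p : CStarSeminorm T) {D : Type v} [CStarAlgebra D]
    (f : p.Completion →⋆ₐ[ℂ] D) (a : T) : ‖f.comp p.toCompletion a‖ ≤ p a :=
  (StarAlgHom_norm_le f _).trans_eq (p.norm_toCompletion a)

/-- The functional is the compression of ω by the column V, normalised by c = ∑ ω(V_i* V_i). The
entry V i₀ = 1 ensures c ≥ 1, so that r = c⁻¹ makes sense. -/
theorem exists_isState_matrix {Q : Type*} [CStarAlgebra Q] {ι : Type} [Fintype ι] [DecidableEq ι]
    {ω : Q →ₗ[ℂ] ℂ} (hω : IsState ω) (V : ι → Q) {i₀ : ι} (hV : V i₀ = 1) :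
    ∃ (S : CStarMatrix ι ι Q →ₗ[ℂ] ℂ) (r : ℝ), 0 < r ∧ IsState S ∧
      ∀ N, S N = r * ∑ i, ∑ j, ω (star (V i) * N i j * V j) := by
  let s : ι → ι → Q →ₗ[ℂ] ℂ := fun i j =>
    ω ∘ₗ LinearMap.mulRight ℂ (V j) ∘ₗ LinearMap.mulLeft ℂ (star (V i))
  have hs : IsPosDefFamily s := fun a => by
    have h := hω.positive (∑ i, a i * V i)
    rw [star_sum, Finset.sum_mul_sum] at h
    simpa only [s, LinearMap.comp_apply, LinearMap.mulRight_apply, LinearMap.mulLeft_apply,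
      map_sum, star_mul, mul_assoc] using h
  have hS : IsPositiveFunctional (matrixFunctional s) := hs.isPositiveFunctional
  have happ : ∀ N, matrixFunctional s N = ∑ i, ∑ j, ω (star (V i) * N i j * V j) := fun N => rfl
  obtain ⟨c, hc, hc1⟩ : ∃ c : ℝ, 1 ≤ c ∧ matrixFunctional s 1 = c := by
    have h1 : matrixFunctional s 1 = ∑ i, ω (star (V i) * V i) := by
      rw [happ]
      refine Finset.sum_congr rfl fun i _ => ?_
      rw [Finset.sum_eq_single i]
      · rw [one_apply_eq, mul_one]
      · intro j _ hj
        rw [one_apply_ne hj.symm, mul_zero, zero_mul, map_zero]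
      · simp
    have h2 : (1 : ℂ) ≤ matrixFunctional s 1 := by
      rw [h1]
      refine le_trans ?_ (Finset.single_le_sum (fun i _ => hω.positive (V i)) (Finset.mem_univ i₀))
      rw [hV, star_one, one_mul, hω.map_one]
    refine ⟨(matrixFunctional s 1).re, (Complex.le_def.1 h2).1, ?_⟩
    exact Complex.ext rfl (by simpa using (Complex.le_def.1 h2).2.symm)
  have hc0 : 0 < c := one_pos.trans_le hc
  refine ⟨((c⁻¹ : ℝ) : ℂ) • matrixFunctional s, c⁻¹, inv_pos.2 hc0, ⟨fun N => ?_, ?_⟩, fun N => rfl⟩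
  · exact mul_nonneg (Complex.zero_le_real.2 (inv_pos.2 hc0).le) (hS N)
  · change ((c⁻¹ : ℝ) : ℂ) * matrixFunctional s 1 = 1
    rw [hc1, ← Complex.ofReal_mul, inv_mul_cancel₀ hc0.ne', Complex.ofReal_one]

section Amplified

variable {Q B : Type*} [CStarAlgebra Q] [CStarAlgebra B] {ι : Type} [Fintype ι] [DecidableEq ι]

theorem commute_diagHom_mapHom {p : Q} {β : B →⋆ₐ[ℂ] Q} (h : ∀ b, Commute p (β b))
    (d : CStarMatrix ι ι B) : Commute (diagHom p : CStarMatrix ι ι Q) (mapHom β d) := by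
  ext i j
  rw [diagHom_mul_apply, mul_diagHom_apply]
  exact h _

theorem diagHom_mul_mapHom_entry (p : Q) (β : B →⋆ₐ[ℂ] Q) (i j : ι) (b : B) :
    (diagHom p * mapHom β (entry i j b) : CStarMatrix ι ι Q) = entry i j (p * β b) := by
  have h : mapHom β (entry i j b) = entry i j (β b) := by
    ext k l
    rw [mapHom_apply, entry_apply, entry_apply, apply_ite β, map_zero]
  rw [h, diagHom_mul_entry]

theorem sum_sum_entry (f : ι → ι → Q → ℂ) (hf : ∀ i j, f i j 0 = 0) (i j : ι) (q : Q) :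
    ∑ k, ∑ l, f k l (entry i j q k l) = f i j q := by
  rw [Finset.sum_eq_single i, Finset.sum_eq_single j]
  · rw [entry_apply, if_pos ⟨rfl, rfl⟩]
  · intro l _ hl
    rw [entry_apply, if_neg fun h => hl h.2.symm, hf]
  · simp
  · intro k _ hk
    refine Finset.sum_eq_zero fun l _ => ?_
    rw [entry_apply, if_neg fun h => hk h.1.symm, hf]
  · simp

end Amplified

variable {m k : ℕ} {Q B : Type u} [CStarAlgebra Q] [CStarAlgebra B] {ι : Type} [Fintype ι]
  [DecidableEq ι]

/-- This is where the hypothesis on assemblages is used: the projections act on matrices over `Q` as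
constant diagonals, hence commute with M_ι(β(B)), and the tensor model reproduces their first
moments against every matrix unit. -/
theorem exists_minTensor_moments (x₀ : Fin m)
    (hqc : qcA m k (CStarMatrix ι ι B) ⊆ qA m k (CStarMatrix ι ι B))
    {β : B →⋆ₐ[ℂ] Q} (hβ : Function.Injective β) {p : Fin k → Fin m → Q}
    (hp : ∀ x, IsPVM fun a => p a x) (hcomm : ∀ a x b, Commute (p a x) (β b))
    {ω : Q →ₗ[ℂ] ℂ} (hω : IsState ω) (V : ι → Q) {i₀ : ι} (hV : V i₀ = 1) :
    ∃ (H : Type u) (_ : NormedAddCommGroup H) (_ : InnerProductSpace ℂ H) (_ : CompleteSpace H)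
      (φ : MinTensor (H →L[ℂ] H) (CStarMatrix ι ι B) →ₗ[ℂ] ℂ) (P : Fin k → Fin m → (H →L[ℂ] H))
      (r : ℝ), IsState φ ∧ (∀ x, IsPVM fun a => P a x) ∧ 0 < r ∧
      (∀ i j b, φ ((minTensorNorm (H →L[ℂ] H) (CStarMatrix ι ι B)).toCompletion
        (1 ⊗ₜ entry i j b)) = r * ω (star (V i) * β b * V j)) ∧
      ∀ a x i j b, φ ((minTensorNorm (H →L[ℂ] H) (CStarMatrix ι ι B)).toCompletion
        (P a x ⊗ₜ entry i j b)) = r * ω (star (V i) * (p a x * β b) * V j) := by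
  obtain ⟨S, r, hr, hS, hSr⟩ := exists_isState_matrix hω V hV
  let σ : Fin k → Fin m → (CStarMatrix ι ι B →ₗ[ℂ] ℂ) := fun a x =>
    S ∘ₗ LinearMap.mulLeft ℂ (diagHom (p a x)) ∘ₗ (mapHom β).toAlgHom.toLinearMap
  have hσ : σ ∈ qcA m k (CStarMatrix ι ι B) :=
    mem_qcA_of_commute (mapHom β) (mapHom_injective hβ) (fun a x => diagHom (p a x))
      (fun x => (hp x).map (diagHom : Q →⋆ₐ[ℂ] CStarMatrix ι ι Q))
      (fun a x => commute_diagHom_mapHom (hcomm a x)) hS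
      fun a x d => rfl
  obtain ⟨-, H, _, _, _, φ, P, hφ, hP, hφσ⟩ := hqc hσ
  have hgen : ∀ a x i j b, φ ((minTensorNorm (H →L[ℂ] H) (CStarMatrix ι ι B)).toCompletion
      (P a x ⊗ₜ entry i j b)) = r * ω (star (V i) * (p a x * β b) * V j) := by
    intro a x i j b
    rw [← hφσ]
    change S (diagHom (p a x) * mapHom β (entry i j b)) = _
    rw [diagHom_mul_mapHom_entry, hSr,
      sum_sum_entry (fun i j q => ω (star (V i) * q * V j)) fun i j => by simp]
  refine ⟨H, _, _, _, φ, P, r, hφ, hP, hr, fun i j b => ?_, hgen⟩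
  -- Moments without a projection come from summing over the outcomes of one measurement, hence the
  -- need for some `x₀`.
  rw [← (hP x₀).sum_eq_one, TensorProduct.sum_tmul, map_sum, map_sum,
    Finset.sum_congr rfl fun a _ => hgen a x₀ i j b, ← Finset.mul_sum, ← map_sum, ← Finset.sum_mul,
    ← Finset.mul_sum, ← Finset.sum_mul, (hp x₀).sum_eq_one, one_mul]

/-- The column V consists of the words w ⊗ 1. The moment estimate then bounds ω(x* x) by the norm of
x in a representation that factors through the minimal tensor product; r cancels because ω(1) = 1.
-/
theorem re_apply_le_of_qcA_subset_qA [Nontrivial (UniversalPVM m k)] (x₀ : Fin m)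
    (hqc : qcA m k (CStarMatrix ι ι B) ⊆ qA m k (CStarMatrix ι ι B))
    {ω : MaxTensor (UniversalPVM m k) B →ₗ[ℂ] ℂ} (hω : IsState ω)
    {v : ι → List (Fin k × Fin m)} (hv : Function.Injective v)
    (htail : ∀ i g w, v i = g :: w → ∃ j, v j = w) (i₀ : ι) (hi₀ : v i₀ = [])
    (b : ι → B) {x : UniversalPVM m k ⊗[ℂ] B} (hx : x = ∑ i, pvmWord m k (v i) ⊗ₜ b i) :
    (ω ((maxTensorNorm (UniversalPVM m k) B).toCompletion (star x * x))).re ≤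
      minTensorNorm (UniversalPVM m k) B x ^ 2 := by
  obtain ⟨τ, hτ⟩ : ∃ τ, τ = (maxTensorNorm (UniversalPVM m k) B).toCompletion := ⟨_, rfl⟩
  have hβ : Function.Injective (τ.comp (tensorInclRight (UniversalPVM m k) B)) := by
    rw [hτ]
    exact toCompletion_inclRight_injective _ minTensorNorm_le_maxTensorNorm
  rw [← hτ]
  obtain ⟨H, _, _, _, φ, P, r, hφ, hP, hr, h1, h2⟩ := exists_minTensor_moments x₀ hqc hβ
    (p := fun a x => τ (pvmGen m k a x ⊗ₜ 1))
    (fun x => (isPVM_pvmGen m k x).map (τ.comp (tensorInclLeft (UniversalPVM m k) B)))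
    (fun a x b => by
      change τ (pvmGen m k a x ⊗ₜ 1) * τ (1 ⊗ₜ b) = τ (1 ⊗ₜ b) * τ (pvmGen m k a x ⊗ₜ 1)
      rw [← map_mul, ← map_mul, Algebra.TensorProduct.tmul_mul_tmul,
        Algebra.TensorProduct.tmul_mul_tmul, one_mul, mul_one, one_mul, mul_one]) hω
    (fun i => τ (pvmWord m k (v i) ⊗ₜ 1)) (i₀ := i₀) (by
      rw [hi₀, pvmWord, List.map_nil, List.prod_nil, ← Algebra.TensorProduct.one_def, map_one])
  have hword1 : ∀ i l c, star (τ (pvmWord m k (v i) ⊗ₜ 1)) * τ (1 ⊗ₜ c) *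
      τ (pvmWord m k (v l) ⊗ₜ 1) = τ ((star (pvmWord m k (v i)) * pvmWord m k (v l)) ⊗ₜ c) :=
    fun i l c => by
      rw [← map_star, ← map_mul, ← map_mul, TensorProduct.star_tmul,
        Algebra.TensorProduct.tmul_mul_tmul, Algebra.TensorProduct.tmul_mul_tmul, star_one,
        one_mul, mul_one, mul_one]
  have hword2 : ∀ a y i l, star (τ (pvmWord m k (v i) ⊗ₜ 1)) *
      (τ (pvmGen m k a y ⊗ₜ 1) * τ (1 ⊗ₜ 1)) * τ (pvmWord m k (v l) ⊗ₜ 1) =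
        τ ((star (pvmWord m k (v i)) * (pvmGen m k a y * pvmWord m k (v l))) ⊗ₜ 1) :=
    fun a y i l => by
      rw [← map_star, ← map_mul, ← map_mul, ← map_mul, TensorProduct.star_tmul,
        Algebra.TensorProduct.tmul_mul_tmul, Algebra.TensorProduct.tmul_mul_tmul,
        Algebra.TensorProduct.tmul_mul_tmul, star_one, one_mul, mul_one, mul_one, mul_assoc,
        mul_one]
  obtain ⟨θ, hθ⟩ := exists_universalPVM_lift m k P hP
  obtain ⟨G, _, _, _, Γ, Ω, hΓ⟩ := hφ.positive.exists_gns
  obtain ⟨δ, hδ⟩ : ∃ δ : B →⋆ₐ[ℂ] CStarMatrix ι ι B, δ = diagHom := ⟨_, rfl⟩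
  have hmain := mul_re_apply_le_of_moments (p := fun g : Fin k × Fin m => pvmGen m k g.1 g.2)
    (fun g => (isPVM_pvmGen m k g.2).projection g.1) θ
    δ entry star_entry (fun i j l b c => by rw [entry_mul_entry, if_pos rfl])
    (fun i j b c => by rw [hδ, diagHom_mul_entry])
    (Γ.comp (minTensorNorm (H →L[ℂ] H) (CStarMatrix ι ι B)).toCompletion) Ω
    (ω ∘ₗ τ.toAlgHom.toLinearMap) r v hv htail i₀ hi₀
    (fun i l c => (hΓ _).trans ((h1 i l c).trans (congrArg (fun z => r * ω z) (hword1 i l c))))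
    (fun g i l => by
      rw [hθ]
      exact (hΓ _).trans ((h2 g.1 g.2 i l 1).trans
        (congrArg (fun z => r * ω z) (hword2 g.1 g.2 i l)))) b hx
  have h3 : ‖Γ.comp (minTensorNorm (H →L[ℂ] H) (CStarMatrix ι ι B)).toCompletion
      (tensorMap θ δ x)‖ ≤ minTensorNorm (UniversalPVM m k) B x :=
    (norm_comp_toCompletion_le _ Γ _).trans (minTensorNorm_map_le θ δ x)
  have hμ : ∀ y, (ω ∘ₗ τ.toAlgHom.toLinearMap) y = ω (τ y) := fun y => rfl
  rw [hμ, hμ, map_one τ, hω.map_one, Complex.one_re, mul_one, mul_comm] at hmain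
  exact (le_of_mul_le_mul_right hmain hr).trans (pow_le_pow_left₀ (norm_nonneg _) h3 2)

end Converse

/-! ### Comparison of the norms on the dense subspace of word tensors. -/

section Nuclearity

variable (m k : ℕ) (B : Type u) [CStarAlgebra B]

/-- The tensors `∑ w, w ⊗ f w` supported on the words in the generators of `C*(m,k)`. -/
noncomputable def wordTensor : (List (Fin k × Fin m) →₀ B) →ₗ[ℂ] UniversalPVM m k ⊗[ℂ] B :=
  Finsupp.lsum ℂ fun w => TensorProduct.mk ℂ (UniversalPVM m k) B (pvmWord m k w)

variable {m k B}

theorem wordTensor_single (w : List (Fin k × Fin m)) (b : B) :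
    wordTensor m k B (Finsupp.single w b) = pvmWord m k w ⊗ₜ b := by
  simp [wordTensor]

theorem exists_wordTensor_eq {a : UniversalPVM m k}
    (ha : a ∈ Submodule.span ℂ (Set.range (pvmWord m k))) (b : B) :
    ∃ f, wordTensor m k B f = a ⊗ₜ b := by
  induction ha using Submodule.span_induction with
  | mem a ha =>
    obtain ⟨w, rfl⟩ := ha
    exact ⟨_, wordTensor_single w b⟩
  | zero => exact ⟨0, by rw [map_zero, TensorProduct.zero_tmul]⟩
  | add a a' _ _ h h' =>
    obtain ⟨f, hf⟩ := h
    obtain ⟨f', hf'⟩ := h'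
    exact ⟨f + f', by rw [map_add, hf, hf', TensorProduct.add_tmul]⟩
  | smul r a _ h =>
    obtain ⟨f, hf⟩ := h
    exact ⟨r • f, by rw [map_smul, hf, TensorProduct.smul_tmul']⟩

theorem exists_maxTensorNorm_sub_wordTensor_lt (x : UniversalPVM m k ⊗[ℂ] B) :
    ∀ ε : ℝ, 0 < ε → ∃ f, maxTensorNorm (UniversalPVM m k) B (x - wordTensor m k B f) < ε := by
  induction x using TensorProduct.induction_on with
  | zero =>
    intro ε hε
    refine ⟨0, ?_⟩
    rw [map_zero, sub_zero]
    exact (map_zero (maxTensorNorm (UniversalPVM m k) B).toSeminorm).trans_lt hε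
  | add x y hx hy =>
    intro ε hε
    obtain ⟨f, hf⟩ := hx (ε / 2) (half_pos hε)
    obtain ⟨g, hg⟩ := hy (ε / 2) (half_pos hε)
    refine ⟨f + g, ?_⟩
    rw [map_add, add_sub_add_comm]
    have h := map_add_le_add (maxTensorNorm (UniversalPVM m k) B).toSeminorm
      (x - wordTensor m k B f) (y - wordTensor m k B g)
    linarith
  | tmul a b =>
    intro ε hε
    have hb : 0 < ‖b‖ + 1 := by positivity
    -- The denominator ‖b‖ + 1 stays positive when b = 0.
    obtain ⟨a', ha', h⟩ := exists_mem_span_pvmWord_norm_sub_lt m k a (div_pos hε hb)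
    obtain ⟨f, hf⟩ := exists_wordTensor_eq ha' b
    refine ⟨f, ?_⟩
    rw [hf, ← TensorProduct.sub_tmul]
    refine (CStarSeminorm.apply_tmul_le _ _ _).trans_lt ?_
    rw [lt_div_iff₀ hb] at h
    nlinarith [norm_nonneg (a - a')]

theorem maxTensorNorm_wordTensor_le (x₀ : Fin m) (hqc : ∀ n : ℕ,
      qcA m k (CStarMatrix (Fin n) (Fin n) B) ⊆ qA m k (CStarMatrix (Fin n) (Fin n) B))
    (f : List (Fin k × Fin m) →₀ B) :
    maxTensorNorm (UniversalPVM m k) B (wordTensor m k B f) ≤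
      minTensorNorm (UniversalPVM m k) B (wordTensor m k B f) := by
  classical
  obtain ⟨x, hx⟩ : ∃ x, x = wordTensor m k B f := ⟨_, rfl⟩
  rw [← hx]
  have h0 : 0 ≤ minTensorNorm (UniversalPVM m k) B x :=
    apply_nonneg (minTensorNorm (UniversalPVM m k) B).toSeminorm x
  have hmax := CStarSeminorm.norm_toCompletion (maxTensorNorm (UniversalPVM m k) B) x
  rcases subsingleton_or_nontrivial (MaxTensor (UniversalPVM m k) B) with hQ | hQ
  · rwa [← hmax, Subsingleton.elim ((maxTensorNorm (UniversalPVM m k) B).toCompletion x) 0,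
      norm_zero]
  have hA : Nontrivial (UniversalPVM m k) := by
    by_contra hA
    rw [not_nontrivial_iff_subsingleton] at hA
    refine zero_ne_one (α := MaxTensor (UniversalPVM m k) B) ?_
    rw [← map_one (maxTensorNorm (UniversalPVM m k) B).toCompletion,
      Algebra.TensorProduct.one_def, Subsingleton.elim (1 : UniversalPVM m k) 0,
      TensorProduct.zero_tmul, map_zero]
  -- With ω(x* x) = ‖x‖²_max, the bound on ω(x* x) becomes the comparison of norms.
  obtain ⟨ω, hω, hωx⟩ := exists_isState_norm_sq
    ((maxTensorNorm (UniversalPVM m k) B).toCompletion x)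
  obtain ⟨L, hL⟩ : ∃ L : ℕ, ∀ w ∈ f.support, w.length ≤ L :=
    ⟨f.support.sup List.length, fun w hw => Finset.le_sup hw⟩
  -- All words of length at most L are taken, not just the support of f, so that the set contains
  -- the empty word and is closed under tails. The added words have coefficient zero.
  let T : Finset (List (Fin k × Fin m)) := (List.finite_length_le (Fin k × Fin m) L).toFinset
  have hT : ∀ w, w ∈ T ↔ w.length ≤ L := fun w => by
    rw [Set.Finite.mem_toFinset]
    rfl
  let v : Fin T.card → List (Fin k × Fin m) := fun i => (T.equivFin.symm i).1
  have hv : Function.Injective v := Subtype.val_injective.comp T.equivFin.symm.injective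
  have hvT : ∀ w ∈ T, ∃ i, v i = w := fun w hw => ⟨T.equivFin ⟨w, hw⟩, by simp [v]⟩
  have hvL : ∀ i, (v i).length ≤ L := fun i => (hT _).1 (T.equivFin.symm i).2
  obtain ⟨i₀, hi₀⟩ := hvT [] ((hT _).2 (Nat.zero_le _))
  have hxv : x = ∑ i, pvmWord m k (v i) ⊗ₜ f (v i) := by
    have h1 : x = ∑ w ∈ T, pvmWord m k w ⊗ₜ f w := by
      rw [hx]
      refine Finsupp.sum_of_support_subset f (fun w hw => (hT w).2 (hL w hw)) _ fun w _ => ?_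
      exact map_zero _
    rw [h1, ← Finset.sum_coe_sort T]
    exact (Equiv.sum_comp T.equivFin.symm
      fun w : T => pvmWord m k (w : List (Fin k × Fin m)) ⊗ₜ[ℂ] f w).symm
  have h := re_apply_le_of_qcA_subset_qA x₀ (hqc _) hω hv
    (fun i g w hw => hvT w ((hT w).2 ((Nat.le_succ _).trans (by
      have := hvL i
      rwa [hw, List.length_cons] at this)))) i₀ hi₀ (fun i => f (v i)) hxv
  rw [map_mul, map_star, hωx, Complex.ofReal_re, hmax] at h
  exact (abs_le_of_sq_le_sq' h h0).2

/-- Without measurements the only word is empty, so a word tensor is elementary and both norms are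
cross norms. -/
theorem maxTensorNorm_wordTensor_le_of_isEmpty [IsEmpty (Fin m)]
    (f : List (Fin k × Fin m) →₀ B) :
    maxTensorNorm (UniversalPVM m k) B (wordTensor m k B f) ≤
      minTensorNorm (UniversalPVM m k) B (wordTensor m k B f) := by
  obtain ⟨b, rfl⟩ : ∃ b, f = Finsupp.single [] b := ⟨f [], by
    refine Finsupp.ext fun w => ?_
    rcases w with _ | ⟨g, w⟩
    · simp
    · exact isEmptyElim g.2⟩
  rw [wordTensor_single]
  exact (CStarSeminorm.apply_tmul_le _ _ _).trans (norm_mul_norm_le_minTensorNorm _ _)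

/-- Word tensors are dense for the maximal norm, which dominates the minimal one, so the inequality
passes to limits. -/
theorem isNuclearPair_of_maxTensorNorm_wordTensor_le
    (h : ∀ f, maxTensorNorm (UniversalPVM m k) B (wordTensor m k B f) ≤
      minTensorNorm (UniversalPVM m k) B (wordTensor m k B f)) :
    IsNuclearPair (UniversalPVM m k) B := by
  have key : ∀ x, maxTensorNorm (UniversalPVM m k) B x = minTensorNorm (UniversalPVM m k) B x := by
    intro x
    refine le_antisymm (le_of_forall_pos_le_add fun ε hε => ?_) (minTensorNorm_le_maxTensorNorm x)
    obtain ⟨f, hf⟩ := exists_maxTensorNorm_sub_wordTensor_lt x (ε / 2) (half_pos hε)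
    obtain ⟨y, hy⟩ : ∃ y, y = wordTensor m k B f := ⟨_, rfl⟩
    have h1 := h f
    rw [← hy] at hf h1
    have h2 := map_add_le_add (maxTensorNorm (UniversalPVM m k) B).toSeminorm (x - y) y
    have h3 := map_add_le_add (minTensorNorm (UniversalPVM m k) B).toSeminorm (y - x) x
    have h4 := map_sub_rev (minTensorNorm (UniversalPVM m k) B).toSeminorm y x
    have h5 := minTensorNorm_le_maxTensorNorm (x - y)
    rw [sub_add_cancel] at h2 h3
    linarith
  have hs : (maxTensorNorm (UniversalPVM m k) B).toSeminorm =
      (minTensorNorm (UniversalPVM m k) B).toSeminorm := Seminorm.ext key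
  unfold IsNuclearPair
  revert hs
  generalize maxTensorNorm (UniversalPVM m k) B = p
  generalize minTensorNorm (UniversalPVM m k) B = q
  intro hs
  cases p
  cases q
  cases hs
  rfl

end Nuclearity

theorem mainTheorem3 {B : Type u} [CStarAlgebra B] (m k : ℕ) :
    IsNuclearPair (UniversalPVM m k) B ↔
      ∀ n : ℕ, qA m k (CStarMatrix (Fin n) (Fin n) B) = qcA m k (CStarMatrix (Fin n) (Fin n) B) := by
  refine ⟨IsNuclearPair.qA_eq_qcA m k, fun h => ?_⟩
  refine isNuclearPair_of_maxTensorNorm_wordTensor_le fun f => ?_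
  -- For m = 0 an assemblage is an empty family and carries no information, so this case is settled
  -- without the hypothesis.
  rcases isEmpty_or_nonempty (Fin m) with _ | ⟨⟨x₀⟩⟩
  · exact maxTensorNorm_wordTensor_le_of_isEmpty f
  · exact maxTensorNorm_wordTensor_le x₀ (fun n => (h n).ge) f
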